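/- An instance of the monotone matroid secretary problem consists of a finite ground set $N$ of $n$ elements, a set function $f:2^N\to\mathbb{R}_{\ge 0}$ that is monotone ($f(S)\le f(T)$ whenever $S\subseteq T$), and a matroid $M$ on $N$, of rank $k$. For $u\in N$ and $S\subseteq N$ write $f(u\mid S)=f(S\cup\{u\})-f(S)$, let $D(u)=\{v\in N:\ f(u\mid S\cup\{v\})>f(u\mid S)\text{ for some }S\subseteq N\}$, and let $d=\max_{u\in N}|D(u)|$ be the supermodular degree of $f$ (with $d=0$ if $N=\varnothing$). The elements of $N$ are revealed one by one in a uniformly random order, and upon each arrival a (randomized) online algorithm must irrevocably accept or reject the revealed element; the set of accepted elements has to be independent in $M$. The algorithm knows in advance $N$ (hence $n$) and $d$, and has an independence oracle for $M$, which tells for any $S\subseteq N$ whether $S$ is independent. At any time it may, moreover, ask the online marginal oracle for $f(u\mid S)$, for any already revealed $u$ and any $S\subseteq N$ (revealed or not), and the online supermodular oracle for $D(u)$, for any already revealed $u$. The function $f$ is not otherwise accessible. Theorem. There are an absolute constant $C>0$ and a single randomized online algorithm that, on every such instance, always outputs an independent set, and whose output $\mathrm{ALG}$ satisfies $$\max_{T\text{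 independent in }M} f(T)\ \le\ C\Bigl((d+1)^3\log(d+2)+(d+1)^2\log(k+1)\Bigr)\cdot\mathbb{E}[f(\mathrm{ALG})],$$ where the expectation is over the arrival order and the random choices of the algorithm (which are independent of that order). In other words, the algorithm is $O(d^3\log d+d^2\log k)$-competitive, with the $O$-expression read as the displayed one so that it also makes sense for $d\le 1$ and $k\le 1$. -/

import Mathlib

universe u

namespace MatroidSecretary

/-- The marginal contribution `f(u ∣ S) = f(S + u) - f(S)`. -/
def marginal {N : Type*} [DecidableEq N] (f : Finset N → ℝ) (u : N) (S : Finset N) : ℝ :=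
  f (insert u S) - f S

/-- The supermodular dependency set of `u`: all elements `v` whose addition to some set `S`
strictly increases the marginal contribution of `u`. -/
noncomputable def depSet {N : Type*} [Fintype N] [DecidableEq N] (f : Finset N → ℝ) (u : N) :
    Finset N :=
  Finset.univ.filter fun v => ∃ S : Finset N, marginal f u S < marginal f u (insert v S)

/-- The supermodular degree of `f`: the maximum of `|depSet f u|` over all `u`
(and `0` for the empty ground set). -/
noncomputable def supermodularDegree {N : Type*} [Fintype N] [DecidableEq N]
    (f : Finset N → ℝ) : ℕ :=
  Finset.univ.sup fun u => (depSet f u).card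

/-- What an online algorithm sees at the time of a decision, apart from the data known in advance:
the elements revealed so far, in their order of arrival (the last one is the element to be decided
upon), the answers of the online marginal oracle, which can be asked about `f(u ∣ S)` for a revealed
element `u` and an arbitrary set `S`, and those of the online supermodular oracle, which returns the
dependency set of a revealed element. -/
structure View (N : Type*) where
  arrived : List N
  marginalOracle : {u : N // u ∈ arrived} → Finset N → ℝ
  supermodularOracle : {u : N // u ∈ arrived} → Finset N

/-- A deterministic rule that accepts (`true`) or rejects (`false`) the last arrived element.
Earlier decisions need not be recorded in the view: each of them was a function of an earlier view,
which is contained in the present one. -/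
abbrev DecisionRule (N : Type*) := View N → Bool

/-- A randomized online algorithm. It knows in advance the ground set `N` (hence also its
size), the supermodular degree `d` of the objective, and has the independence oracle of the matroid.
Given these it draws, by its own random choices, a deterministic decision rule. -/
abbrev SecretaryAlgorithm : Type (u + 1) :=
  ∀ (N : Type u) [Fintype N] [DecidableEq N] (_d : ℕ) (_indep : Finset N → Prop),
    PMF (DecisionRule N)

/-- The view at step `i`, for the arrival order `σ`. -/
noncomputable def viewAt {N : Type*} [Fintype N] [DecidableEq N] (f : Finset N → ℝ)
    (σ : Fin (Fintype.card N) ≃ N) (i : Fin (Fintype.card N)) : View N where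
  arrived := (List.ofFn σ).take (i + 1)
  marginalOracle := fun u S => marginal f u S
  supermodularOracle := fun u => depSet f u

/-- The set of elements accepted by a decision rule, for the arrival order `σ`. -/
noncomputable def output {N : Type*} [Fintype N] [DecidableEq N] (r : DecisionRule N)
    (f : Finset N → ℝ) (σ : Fin (Fintype.card N) ≃ N) : Finset N :=
  (Finset.univ.filter fun i => r (viewAt f σ i) = true).map σ.toEmbedding

/-- The uniformly random arrival order. -/
noncomputable def arrivalLaw (N : Type*) [Fintype N] [DecidableEq N] :
    PMF (Fin (Fintype.card N) ≃ N) :=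
  haveI : Nonempty (Fin (Fintype.card N) ≃ N) := ⟨(Fintype.equivFin N).symm⟩
  PMF.uniformOfFintype (Fin (Fintype.card N) ≃ N)

/-- The law of the set that the algorithm selects on the instance `(N, f, M)`: the arrival order is
uniformly random and independent of the random choices of the algorithm. -/
noncomputable def outputLaw (A : SecretaryAlgorithm.{u}) {N : Type u} [Fintype N] [DecidableEq N]
    (f : Finset N → ℝ) (M : Matroid N) : PMF (Finset N) :=
  (arrivalLaw N).bind fun σ =>
    (A N (supermodularDegree f) (fun S : Finset N => M.Indep (S : Set N))).map
      fun r => output r f σ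

/-- The algorithm always selects an independent set. -/
def IsFeasibleOn (A : SecretaryAlgorithm.{u}) {N : Type u} [Fintype N] [DecidableEq N]
    (f : Finset N → ℝ) (M : Matroid N) : Prop :=
  ∀ S ∈ (outputLaw A f M).support, M.Indep (S : Set N)

/-- The expected value of the selected set, over the arrival order and the random choices of the
algorithm. -/
noncomputable def expectedValue (A : SecretaryAlgorithm.{u}) {N : Type u} [Fintype N] [DecidableEq N]
    (f : Finset N → ℝ) (M : Matroid N) : ℝ :=
  ∑ S : Finset N, (outputLaw A f M S).toReal * f S

/-- The offline optimum, the largest value of an independent set, is at most `ρ` times the expected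
value of the selected set. -/
def IsCompetitiveOn (A : SecretaryAlgorithm.{u}) {N : Type u} [Fintype N] [DecidableEq N]
    (f : Finset N → ℝ) (M : Matroid N) (ρ : ℝ) : Prop :=
  ∀ T : Finset N, M.Indep (T : Set N) → f T ≤ ρ * expectedValue A f M

end MatroidSecretary

set_option linter.unusedSectionVars false

namespace MatroidSecretary

/-! ### Threshold rule for a fixed arrival order -/

section Deterministic

variable {N : Type*} [Fintype N] [DecidableEq N]

/-! ### Marginals and dependency sets -/

/-! Let d be the supermodular degree. The algorithm samples the first K arrivals, K binomial with
parameter p = 1/(d+2), and lets W be the largest marginal f(u | S) with u sampled and S + u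
independent. Then it runs a threshold rule with τ = cW: an arriving u is committed together with its
best set of unrevealed dependencies if this keeps independence and the marginal of u exceeds τ. Here
c is 1, 1/2 or a random 2^-j with j ≤ L = ⌈log₂ rank⌉, each option having probability 1/3.

For a fixed order let B be the final set. Each commitment adds at most d+1 elements and gains more
than τ, so τ|B| ≤ (d+1) f(B). Non-dependencies never raise a marginal, so an element compatible with
B has marginal at most τ over B and the later arrivals (`IsRun.marginal_le`). Matroid exchange then
shows that an independent Y has only O((d+1)²) f(B)/τ elements of marginal above 2τ
(`IsRun.threshold_mul_card_le`). Summing over geometric thresholds recovers f(Y), provided Y arrives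
after the sample and its elements have values at most W (`le_sum_selectedValue`).

Two facts remove the proviso. The largest single value m is O((d+1)²) times the expected gain from c
= 1 and c = 1/2: with probability Ω(1/(d+1)²) the best element precedes its supporting dependencies,
all of them miss the sample, and the best outside element is sampled (`soloValue_le`). And the d+1
most valuable elements H can be deleted from the optimum at cost (d+1)m; the sample hits H with
probability at least 1/2, and independently each other element of the optimum, with its remaining
dependencies there, escapes with probability at least 1/3 (`le_avg_sdiff_past`). The cost of order
(d+1)m gives the cubic term, the L+1 thresholds the term with log k. -/

theorem marginal_nonneg {f : Finset N → ℝ} (hf : Monotone f) (u : N) (S : Finset N) :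
    0 ≤ marginal f u S :=
  sub_nonneg.2 (hf (Finset.subset_insert u S))

theorem marginal_of_mem {f : Finset N → ℝ} {u : N} {S : Finset N} (h : u ∈ S) :
    marginal f u S = 0 := by
  simp [marginal, Finset.insert_eq_of_mem h]

theorem mem_depSet {f : Finset N → ℝ} {u v : N} :
    v ∈ depSet f u ↔ ∃ S : Finset N, marginal f u S < marginal f u (insert v S) := by
  simp [depSet]

/-- The condition says that the second difference f(S+u+v) - f(S+u) - f(S+v) + f(S) is positive,
which is symmetric in u and v. -/
theorem mem_depSet_comm {f : Finset N → ℝ} {u v : N} : v ∈ depSet f u ↔ u ∈ depSet f v := by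
  simp only [mem_depSet, marginal]
  refine exists_congr fun S => ?_
  rw [Finset.insert_comm]
  constructor <;> intro h <;> linarith

theorem card_depSet_le (f : Finset N → ℝ) (u : N) : (depSet f u).card ≤ supermodularDegree f :=
  Finset.le_sup (f := fun u => (depSet f u).card) (Finset.mem_univ u)

/-- A single non-dependency raises the marginal of u over no set; the elements of T \ S are added
one at a time. -/
theorem marginal_le_of_disjoint {f : Finset N → ℝ} {u : N} {S T : Finset N} (hST : S ⊆ T)
    (h : ∀ v ∈ T, v ∉ S → v ∉ depSet f u) : marginal f u T ≤ marginal f u S := by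
  obtain ⟨X, rfl⟩ : ∃ X, T = X ∪ S := ⟨T, (Finset.union_eq_left.2 hST).symm⟩
  clear hST
  induction X using Finset.induction_on with
  | empty => simp
  | insert v X _ ih =>
    have ih' := ih fun w hw => h w (by
      rw [Finset.insert_union]; exact Finset.mem_insert_of_mem hw)
    by_cases hv : v ∈ S
    · rwa [Finset.insert_union, Finset.insert_eq_of_mem (Finset.mem_union_right X hv)]
    · have h1 := h v (by simp) hv
      rw [mem_depSet] at h1
      push Not at h1
      rw [Finset.insert_union]
      exact (h1 _).trans ih'

theorem marginal_le_inter_depSet (f : Finset N → ℝ) (u : N) (S : Finset N) :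
    marginal f u S ≤ marginal f u (S ∩ depSet f u) :=
  marginal_le_of_disjoint Finset.inter_subset_left fun _ hv hv' hd =>
    hv' (Finset.mem_inter.2 ⟨hv, hd⟩)

/-- Telescoping along an order in which the elements with large `pos` come first. -/
theorem union_eq_add_sum_marginal (f : Finset N → ℝ) {pos : N → ℕ} (hpos : Function.Injective pos)
    (B Y : Finset N) :
    f (B ∪ Y) = f B + ∑ u ∈ Y, marginal f u (B ∪ Y.filter fun y => pos u < pos y) := by
  induction Y using Finset.induction_on_min_value pos with
  | empty => simp
  | insert a s ha hmin ih =>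
    rw [Finset.sum_insert ha]
    have h1 : (insert a s).filter (fun y => pos a < pos y) = s := by
      ext y
      simp only [Finset.mem_filter, Finset.mem_insert]
      constructor
      · rintro ⟨rfl | h, h'⟩
        · exact absurd h' (lt_irrefl _)
        · exact h
      · intro h
        refine ⟨Or.inr h, lt_of_le_of_ne (hmin y h) fun e => ha ?_⟩
        rwa [hpos e]
    have h2 : ∀ u ∈ s, (insert a s).filter (fun y => pos u < pos y)
        = s.filter (fun y => pos u < pos y) := by
      intro u hu
      rw [Finset.filter_insert, if_neg (not_lt.2 (hmin u hu))]
    rw [h1, Finset.sum_congr rfl fun u hu => by rw [h2 u hu], Finset.union_insert]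
    simp only [marginal] at ih ⊢
    linarith

theorem eq_add_sum_marginal (f : Finset N → ℝ) {pos : N → ℕ} (hpos : Function.Injective pos)
    (Y : Finset N) :
    f Y = f ∅ + ∑ u ∈ Y, marginal f u (Y.filter fun y => pos u < pos y) := by
  simpa using union_eq_add_sum_marginal f hpos ∅ Y

/-- By symmetry of dependence the counted elements lie in the union of the dependency sets of Z. -/
theorem card_filter_depSet_meets_le (f : Finset N → ℝ) (Y Z : Finset N) :
    ((Y.filter fun u => ∃ v ∈ Z, v ∈ depSet f u).card : ℝ) ≤ supermodularDegree f * Z.card := by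
  have h1 : (Y.filter fun u => ∃ v ∈ Z, v ∈ depSet f u) ⊆ Z.biUnion (depSet f) := by
    intro u hu
    obtain ⟨_, v, hv, h⟩ := Finset.mem_filter.1 hu
    exact Finset.mem_biUnion.2 ⟨v, hv, mem_depSet_comm.1 h⟩
  have h2 := (Finset.card_le_card h1).trans
    (Finset.card_biUnion_le_card_mul Z (depSet f) _ fun v _ => card_depSet_le f v)
  rw [mul_comm]
  exact_mod_cast h2

/-- A common extension property of two independent sets. -/
theorem exists_subset_indep_union {M : Matroid N} {B Y : Finset N} (hB : M.Indep (B : Set N))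
    (hY : M.Indep (Y : Set N)) :
    ∃ Y' ⊆ Y, M.Indep (((B ∪ Y' : Finset N)) : Set N) ∧ (Y \ Y').card ≤ B.card := by
  have hE : ((B : Set N) ∪ Y) ⊆ M.E := Set.union_subset hB.subset_ground hY.subset_ground
  obtain ⟨I, hI, hBI⟩ := hB.subset_isBasis_of_subset Set.subset_union_left hE
  obtain ⟨J, hJ, hYJ⟩ := hY.subset_isBasis_of_subset Set.subset_union_right hE
  have hIJ := hI.encard_eq_encard hJ
  classical
  refine ⟨Y.filter fun y => y ∈ I, Finset.filter_subset _ _, hI.indep.subset ?_, ?_⟩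
  · intro x hx
    simp only [Finset.coe_union, Finset.coe_filter, Set.mem_union, Finset.mem_coe,
      Set.mem_ofPred_eq] at hx
    rcases hx with hx | hx
    · exact hBI hx
    · exact hx.2
  -- The bases I and J have equal size, so |Y| ≤ |I|, while I lies in B ∪ Y' with Y' = Y ∩ I.
  · have h1 : (Y : Set N).encard ≤ I.encard := hIJ ▸ Set.encard_le_encard hYJ
    have h2 : I ⊆ (B ∪ Y.filter (fun y => y ∈ I) : Finset N) := by
      intro x hx
      rcases hI.subset hx with h | h
      · simpa using Or.inl h
      · simp only [Finset.coe_union, Finset.coe_filter, Set.mem_union, Finset.mem_coe,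
          Set.mem_ofPred_eq]
        exact Or.inr ⟨h, hx⟩
    have h3 := h1.trans (Set.encard_le_encard h2)
    rw [Set.encard_coe_eq_coe_finsetCard, Set.encard_coe_eq_coe_finsetCard] at h3
    have h4 : Y.card ≤ (B ∪ Y.filter (fun y => y ∈ I)).card := by exact_mod_cast h3
    have h5 := Finset.card_union_le B (Y.filter fun y => y ∈ I)
    have h6 := Finset.card_sdiff_add_card_eq_card (Finset.filter_subset (fun y => y ∈ I) Y)
    omega

/-! ### Runs of the threshold rule -/

/-- One step of the threshold rule: when `u` arrives after the elements of `past`, the committed set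
`B` is extended by `u` and a best set `S` of unrevealed dependencies of `u`, if the value `g (B ∪ S)`
of this extension exceeds the threshold. -/
def IsStep (indep : Finset N → Prop) (τ : ℝ) (g : Finset N → ℝ) (D past : Finset N) (u : N)
    (B B' : Finset N) : Prop :=
  (B' = B ∧ ∀ S ⊆ D \ past, indep (insert u (B ∪ S)) → g (B ∪ S) ≤ τ) ∨
  ∃ S ⊆ D \ past, indep (insert u (B ∪ S)) ∧ B' = insert u (B ∪ S) ∧ τ < g (B ∪ S) ∧
    ∀ S' ⊆ D \ past, indep (insert u (B ∪ S')) → g (B ∪ S') ≤ g (B ∪ S)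

theorem exists_isStep (indep : Finset N → Prop) (τ : ℝ) (g : Finset N → ℝ) (D past : Finset N)
    (u : N) (B : Finset N) : ∃ B', IsStep indep τ g D past u B B' := by
  classical
  by_cases h : ∃ S ⊆ D \ past, indep (insert u (B ∪ S)) ∧ τ < g (B ∪ S)
  · obtain ⟨S₀, h₀, hi₀, hτ₀⟩ := h
    obtain ⟨S, hS, hmax⟩ := Finset.exists_max_image
      ((D \ past).powerset.filter fun S => indep (insert u (B ∪ S))) (fun S => g (B ∪ S))
      ⟨S₀, by simpa using ⟨h₀, hi₀⟩⟩
    simp only [Finset.mem_filter, Finset.mem_powerset, and_imp] at hS hmax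
    exact ⟨_, Or.inr ⟨S, hS.1, hS.2, rfl, hτ₀.trans_le (hmax S₀ h₀ hi₀), hmax⟩⟩
  · push Not at h
    exact ⟨B, Or.inl ⟨rfl, h⟩⟩

/-- The elements that arrive before time `t`. -/
def past (σ : Fin (Fintype.card N) ≃ N) (t : ℕ) : Finset N :=
  Finset.univ.filter fun x => (σ.symm x : ℕ) < t

theorem mem_past {σ : Fin (Fintype.card N) ≃ N} {t : ℕ} {x : N} :
    x ∈ past σ t ↔ (σ.symm x : ℕ) < t := by
  simp [past]

/-- `st t` is the committed set after `t` arrivals when the threshold rule is run for the order `σ`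
after a sampling phase of length `K`. -/
structure IsRun (M : Matroid N) (f : Finset N → ℝ) (τ : ℝ) (σ : Fin (Fintype.card N) ≃ N) (K : ℕ)
    (st : ℕ → Finset N) : Prop where
  zero : ∀ t ≤ K, st t = ∅
  step : ∀ i : Fin (Fintype.card N), K ≤ i →
    IsStep (fun S : Finset N => M.Indep (S : Set N)) τ (marginal f (σ i)) (depSet f (σ i))
      (past σ i) (σ i) (st i) (st (i + 1))

namespace IsRun

variable {M : Matroid N} {f : Finset N → ℝ} {τ : ℝ} {σ : Fin (Fintype.card N) ≃ N} {K : ℕ}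
  {st : ℕ → Finset N}

/-- Induction over the steps of a run. -/
theorem induction (h : IsRun M f τ σ K st) {P : ℕ → Finset N → Prop} (h0 : ∀ t ≤ K, P t ∅)
    (hs : ∀ i : Fin (Fintype.card N), K ≤ i → P i (st i) → P (i + 1) (st (i + 1))) :
    ∀ t ≤ Fintype.card N, P t (st t) := by
  intro t
  induction t with
  | zero => intro _; rw [h.zero 0 (Nat.zero_le K)]; exact h0 0 (Nat.zero_le K)
  | succ t ih =>
    intro ht
    by_cases hK : t + 1 ≤ K
    · rw [h.zero _ hK]; exact h0 _ hK
    · exact hs ⟨t, ht⟩ (by simp; omega) (ih (by omega))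

theorem subset_succ (h : IsRun M f τ σ K st) {t : ℕ} (ht : t < Fintype.card N) :
    st t ⊆ st (t + 1) := by
  by_cases hK : K ≤ t
  · rcases h.step ⟨t, ht⟩ hK with ⟨h1, _⟩ | ⟨S, _, _, h1, _⟩
    · exact h1.symm.subset
    · simp only at h1
      rw [h1]
      exact Finset.subset_union_left.trans (Finset.subset_insert _ _)
  · rw [h.zero t (by omega)]; exact Finset.empty_subset _

theorem subset_of_le (h : IsRun M f τ σ K st) {s t : ℕ} (hst : s ≤ t)
    (ht : t ≤ Fintype.card N) : st s ⊆ st t := by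
  induction t, hst using Nat.le_induction with
  | base => exact subset_rfl
  | succ t _ ih => exact (ih (by omega)).trans (h.subset_succ ht)

theorem indep (h : IsRun M f τ σ K st) : ∀ t ≤ Fintype.card N, M.Indep (st t : Set N) :=
  h.induction (P := fun _ B => M.Indep (B : Set N)) (fun _ _ => by simp) fun i hi ih => by
    rcases h.step i hi with ⟨h1, _⟩ | ⟨S, _, h2, h1, _⟩
    · rwa [h1]
    · rwa [h1]

/-- No element is committed after its arrival. -/
theorem mem_of_mem_past (h : IsRun M f τ σ K st) {s t : ℕ} (hst : s ≤ t)
    (ht : t ≤ Fintype.card N) {x : N} (hx : x ∈ past σ s) (hxt : x ∈ st t) : x ∈ st s := by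
  induction t, hst using Nat.le_induction with
  | base => exact hxt
  | succ t hs ih =>
    apply ih (by omega)
    by_cases hK : K ≤ t
    · rcases h.step ⟨t, ht⟩ hK with ⟨h1, _⟩ | ⟨S, hS, _, h1, _⟩
      · rwa [h1] at hxt
      · simp only at h1
        rw [mem_past] at hx
        rw [h1, Finset.mem_insert, Finset.mem_union] at hxt
        rcases hxt with rfl | hxt | hxt
        · simp at hx; omega
        · exact hxt
        · have := (Finset.mem_sdiff.1 (hS hxt)).2
          rw [mem_past] at this
          simp at this
          omega
    · rw [h.zero _ (by omega)] at hxt; simp at hxt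

/-- The latest commitment alone gains more than τ over a nonnegative value. -/
theorem threshold_le (h : IsRun M f τ σ K st) (hf0 : ∀ S, 0 ≤ f S) :
    ∀ t ≤ Fintype.card N, st t = ∅ ∨ τ ≤ f (st t) :=
  h.induction (P := fun _ B => B = ∅ ∨ τ ≤ f B) (fun _ _ => Or.inl rfl) fun i hi ih => by
    rcases h.step i hi with ⟨h1, _⟩ | ⟨S, _, _, h1, h2, _⟩
    · rwa [h1]
    · right
      rw [h1]
      have := hf0 (st i ∪ S)
      simp only [marginal] at h2
      linarith

/-- Each commitment brings at most d + 1 elements and raises f by more than τ. -/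
theorem card_le (h : IsRun M f τ σ K st) (hτ : 0 ≤ τ) (hf : Monotone f) :
    ∀ t ≤ Fintype.card N,
      τ * (st t).card ≤ ((supermodularDegree f : ℝ) + 1) * (f (st t) - f ∅) :=
  h.induction (P := fun _ B => τ * B.card ≤ ((supermodularDegree f : ℝ) + 1) * (f B - f ∅))
    (fun _ _ => by simp) fun i hi ih => by
    rcases h.step i hi with ⟨h1, _⟩ | ⟨S, hS, _, h1, h2, _⟩
    · rwa [h1]
    · rw [h1]
      have h3 : (insert (σ i) (st i ∪ S)).card ≤ (st i).card + (supermodularDegree f + 1) := by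
        have := Finset.card_insert_le (σ i) (st i ∪ S)
        have := Finset.card_union_le (st i) S
        have := (Finset.card_le_card (hS.trans Finset.sdiff_subset)).trans (card_depSet_le f (σ i))
        omega
      have h4 : ((insert (σ i) (st i ∪ S)).card : ℝ)
          ≤ (st i).card + ((supermodularDegree f : ℝ) + 1) := by exact_mod_cast h3
      have h5 := hf (Finset.subset_union_left : st i ⊆ st i ∪ S)
      simp only [marginal] at h2
      have h6 := mul_le_mul_of_nonneg_left h4 hτ
      have h7 : ((supermodularDegree f : ℝ) + 1) * τ ≤ ((supermodularDegree f : ℝ) + 1) *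
          (f (insert (σ i) (st i ∪ S)) - f (st i)) :=
        mul_le_mul_of_nonneg_left (by linarith) (by positivity)
      nlinarith

/-- Relative to the final committed set, no compatible element has a large marginal. -/
theorem marginal_le (h : IsRun M f τ σ K st) (hτ : 0 ≤ τ) {Y : Finset N}
    (hY : M.Indep ((st (Fintype.card N) ∪ Y : Finset N) : Set N)) {u : N} (hu : u ∈ Y)
    (hK : K ≤ (σ.symm u : ℕ)) :
    marginal f u (st (Fintype.card N) ∪ Y.filter fun y => (σ.symm u : ℕ) < σ.symm y) ≤ τ := by
  obtain ⟨i, rfl⟩ := σ.surjective u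
  simp only [Equiv.symm_apply_apply] at hK ⊢
  have hmono : st i ⊆ st (Fintype.card N) := h.subset_of_le i.2.le le_rfl
  rcases h.step i hK with ⟨_, h2⟩ | ⟨S, hS, _, h1, _⟩
  -- No commitment was triggered by u. The set D(u) ∩ A had not arrived before u and was admissible,
  -- so it failed the test; passing to the full set adds only non-dependencies of u.
  · set A := (st (Fintype.card N) \ st i) ∪ Y.filter fun y => (i : ℕ) < σ.symm y with hA
    have hsub : st i ∪ depSet f (σ i) ∩ A ⊆
        st (Fintype.card N) ∪ Y.filter fun y => (i : ℕ) < σ.symm y := by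
      intro x hx
      simp only [hA, Finset.mem_union, Finset.mem_inter, Finset.mem_sdiff] at hx ⊢
      rcases hx with hx | ⟨_, hx | hx⟩
      · exact Or.inl (hmono hx)
      · exact Or.inl hx.1
      · exact Or.inr hx
    refine (marginal_le_of_disjoint hsub ?_).trans (h2 (depSet f (σ i) ∩ A) ?_ (hY.subset ?_))
    · intro v hv hv' hd
      apply hv'
      simp only [hA, Finset.mem_union, Finset.mem_inter, Finset.mem_sdiff] at hv ⊢
      tauto
    · intro x hx
      obtain ⟨hx1, hx2⟩ := Finset.mem_inter.1 hx
      refine Finset.mem_sdiff.2 ⟨hx1, fun hp => ?_⟩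
      rcases Finset.mem_union.1 hx2 with h3 | h3
      · obtain ⟨h3, h4⟩ := Finset.mem_sdiff.1 h3
        exact h4 (h.mem_of_mem_past i.2.le le_rfl hp h3)
      · have := (Finset.mem_filter.1 h3).2
        rw [mem_past] at hp
        omega
    · rw [Finset.coe_subset]
      refine Finset.insert_subset (Finset.mem_union_right _ hu) (hsub.trans ?_)
      exact Finset.union_subset_union subset_rfl (Finset.filter_subset _ _)
  · rw [marginal_of_mem]
    · exact hτ
    · apply Finset.mem_union_left
      apply h.subset_of_le (Nat.succ_le_of_lt i.2) le_rfl
      change σ i ∈ st (i + 1)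
      rw [h1]
      exact Finset.mem_insert_self _ _

/-- The number of elements of an independent set with marginals above twice the threshold. -/
theorem threshold_mul_card_le (h : IsRun M f τ σ K st) (hτ : 0 ≤ τ) (hf0 : ∀ S, 0 ≤ f S)
    (hf : Monotone f) {Y : Finset N} (hY : M.Indep (Y : Set N))
    (hK : ∀ u ∈ Y, K ≤ (σ.symm u : ℕ)) :
    τ * (Y.filter fun u =>
        2 * τ < marginal f u (Y.filter fun y => (σ.symm u : ℕ) < σ.symm y)).card
      ≤ 2 * ((supermodularDegree f : ℝ) + 1) ^ 2 * f (st (Fintype.card N)) := by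
  set B := st (Fintype.card N) with hB
  set d : ℝ := (supermodularDegree f : ℝ) with hd
  have hd0 : 0 ≤ d := Nat.cast_nonneg _
  obtain ⟨Y', hYY, hind, hcard⟩ := exists_subset_indep_union (h.indep _ le_rfl) hY
  have hpos : Function.Injective fun u : N => (σ.symm u : ℕ) :=
    Fin.val_injective.comp σ.symm.injective
  set Z := Y \ Y' with hZ
  set w : N → ℝ := fun u => marginal f u (Y.filter fun y => (σ.symm u : ℕ) < σ.symm y) with hw
  set w' : N → ℝ := fun u => marginal f u (Y'.filter fun y => (σ.symm u : ℕ) < σ.symm y) with hw'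
  set v : N → ℝ := fun u => marginal f u (B ∪ Y'.filter fun y => (σ.symm u : ℕ) < σ.symm y) with hv
  set good := Y'.filter fun u => 2 * τ < w' u with hgood
  -- Both sums telescope, to f(Y') - f(∅) and f(B ∪ Y') - f(B).
  have hsum : ∑ u ∈ Y', (w' u - v u) ≤ f B := by
    have h1 := eq_add_sum_marginal f hpos Y'
    have h2 := union_eq_add_sum_marginal f hpos B Y'
    have h3 := hf (Finset.subset_union_right : Y' ⊆ B ∪ Y')
    have h4 := hf0 ∅
    rw [Finset.sum_sub_distrib]
    simp only [hw', hv]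
    linarith
  -- An element without dependencies in B has v ≤ w'; any other one has v ≤ τ, so it loses at most
  -- τ. If w' > 2τ, the difference exceeds τ.
  have hpt : ∀ u ∈ Y', (if 2 * τ < w' u then τ else 0)
      - (if ∃ b ∈ B, b ∈ depSet f u then τ else 0) ≤ w' u - v u := by
    intro u hu
    have h1 : v u ≤ τ := h.marginal_le hτ hind hu (hK u (hYY hu))
    have h2 : 0 ≤ w' u := marginal_nonneg hf _ _
    by_cases hb : ∃ b ∈ B, b ∈ depSet f u
    · rw [if_pos hb]
      split_ifs <;> linarith
    · have h3 : v u ≤ w' u := by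
        refine marginal_le_of_disjoint Finset.subset_union_right fun x hx hx' hxd => ?_
        rcases Finset.mem_union.1 hx with hx | hx
        · exact hb ⟨x, hx, hxd⟩
        · exact hx' hx
      rw [if_neg hb]
      split_ifs <;> linarith
  have hgc : τ * good.card - τ * (d * B.card) ≤ f B := by
    refine le_trans ?_ ((Finset.sum_le_sum hpt).trans hsum)
    rw [Finset.sum_sub_distrib, ← Finset.sum_filter, ← Finset.sum_filter, Finset.sum_const,
      Finset.sum_const, nsmul_eq_mul, nsmul_eq_mul]
    have := mul_le_mul_of_nonneg_left (card_filter_depSet_meets_le f Y' B) hτ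
    rw [← hd] at this
    linarith
  -- Passing from Y to Y' lowers a marginal only for elements with a dependency in Z.
  have hbig : (Y.filter fun u => 2 * τ < w u) ⊆
      (Z ∪ Y.filter fun u => ∃ x ∈ Z, x ∈ depSet f u) ∪ good := by
    intro u hu
    obtain ⟨hu, hwu⟩ := Finset.mem_filter.1 hu
    by_cases h1 : u ∈ Y'
    · by_cases h2 : ∃ x ∈ Z, x ∈ depSet f u
      · exact Finset.mem_union_left _ (Finset.mem_union_right _ (Finset.mem_filter.2 ⟨hu, h2⟩))
      · refine Finset.mem_union_right _ (Finset.mem_filter.2 ⟨h1, hwu.trans_le ?_⟩)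
        refine marginal_le_of_disjoint (Finset.filter_subset_filter _ hYY) fun x hx hx' hxd => ?_
        obtain ⟨hx1, hx2⟩ := Finset.mem_filter.1 hx
        refine h2 ⟨x, Finset.mem_sdiff.2 ⟨hx1, fun h => hx' (Finset.mem_filter.2 ⟨h, hx2⟩)⟩, hxd⟩
    · exact Finset.mem_union_left _ (Finset.mem_union_left _ (Finset.mem_sdiff.2 ⟨hu, h1⟩))
  have hbc : ((Y.filter fun u => 2 * τ < w u).card : ℝ) ≤ (d + 1) * B.card + good.card := by
    have h1 := (Finset.card_le_card hbig).trans ((Finset.card_union_le _ _).trans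
      (Nat.add_le_add_right (Finset.card_union_le _ _) _))
    have h2 : ((Y.filter fun u => 2 * τ < w u).card : ℝ) ≤
        Z.card + (Y.filter fun u => ∃ x ∈ Z, x ∈ depSet f u).card + good.card := by
      exact_mod_cast h1
    have h3 := card_filter_depSet_meets_le f Y Z
    rw [← hd] at h3
    have h4 : (Z.card : ℝ) ≤ B.card := by exact_mod_cast hcard
    have h5 := mul_le_mul_of_nonneg_left h4 hd0
    linarith
  have hcB := h.card_le hτ hf _ le_rfl
  rw [← hB, ← hd] at hcB
  have h0 := hf0 ∅
  have hfB := hf0 B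
  have e1 := mul_le_mul_of_nonneg_left hbc hτ
  have e2 : (d + 1) * (τ * B.card) ≤ (d + 1) * ((d + 1) * f B) :=
    mul_le_mul_of_nonneg_left (hcB.trans (mul_le_mul_of_nonneg_left (by linarith)
      (by linarith))) (by linarith)
  have e3 : d * (τ * B.card) ≤ d * ((d + 1) * f B) :=
    mul_le_mul_of_nonneg_left (hcB.trans (mul_le_mul_of_nonneg_left (by linarith)
      (by linarith))) hd0
  -- The total factor is 1 + (2d+1)(d+1) ≤ 2(d+1)².
  nlinarith [mul_nonneg hd0 hfB]

end IsRun

end Deterministic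

/-! ### The decision rule and its guarantees for a fixed order -/

section Algorithm

variable {N : Type*} [Fintype N] [DecidableEq N]

/-! ### Values of single elements -/

open Classical in
/-- The largest value `g S` over the sets `S` that are independent together with `u`. -/
noncomputable def bestMarginal (indep : Finset N → Prop) (g : Finset N → ℝ) (u : N) : ℝ :=
  ⨆ S : Finset N, if indep (insert u S) then g S else 0

theorem le_bestMarginal {indep : Finset N → Prop} (g : Finset N → ℝ) {u : N} {S : Finset N}
    (h : indep (insert u S)) : g S ≤ bestMarginal indep g u := by
  classical
  refine le_trans ?_ (le_ciSup (f := fun S : Finset N => if indep (insert u S) then g S else 0)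
    (Set.finite_range _).bddAbove S)
  rw [if_pos h]

theorem bestMarginal_nonneg {indep : Finset N → Prop} {g : Finset N → ℝ} (hg : ∀ S, 0 ≤ g S)
    (u : N) : 0 ≤ bestMarginal indep g u :=
  Real.iSup_nonneg fun S => by split_ifs <;> simp [hg]

theorem exists_eq_bestMarginal {indep : Finset N → Prop} {g : Finset N → ℝ} {u : N}
    (h : 0 < bestMarginal indep g u) : ∃ S, indep (insert u S) ∧ g S = bestMarginal indep g u := by
  classical
  obtain ⟨S, hS⟩ := exists_eq_ciSup_of_finite
    (f := fun S : Finset N => if indep (insert u S) then g S else 0)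
  change _ = bestMarginal indep g u at hS
  by_cases hi : indep (insert u S)
  · exact ⟨S, hi, by simpa [hi] using hS⟩
  · simp only [hi, if_false] at hS
    exact absurd hS h.ne

/-- The largest value of a single element of the sample `A` (`0` if the sample is empty). -/
noncomputable def sampleMax (indep : Finset N → Prop) (g : N → Finset N → ℝ) (A : Finset N) : ℝ :=
  ⨆ u : N, if u ∈ A then bestMarginal indep (g u) u else 0

theorem le_sampleMax {indep : Finset N → Prop} (g : N → Finset N → ℝ) {A : Finset N} {u : N}
    (h : u ∈ A) : bestMarginal indep (g u) u ≤ sampleMax indep g A := by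
  refine le_trans ?_ (le_ciSup (f := fun u : N => if u ∈ A then bestMarginal indep (g u) u else 0)
    (Set.finite_range _).bddAbove u)
  rw [if_pos h]

theorem sampleMax_nonneg {indep : Finset N → Prop} {g : N → Finset N → ℝ} (hg : ∀ u S, 0 ≤ g u S)
    (A : Finset N) : 0 ≤ sampleMax indep g A :=
  Real.iSup_nonneg fun u => by
    split_ifs
    · exact bestMarginal_nonneg (hg u) u
    · exact le_rfl

theorem sampleMax_le {indep : Finset N → Prop} {g : N → Finset N → ℝ} {A : Finset N} {m : ℝ}
    (hm : 0 ≤ m) (h : ∀ u, bestMarginal indep (g u) u ≤ m) : sampleMax indep g A ≤ m :=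
  Real.iSup_le (fun u => by split_ifs <;> simp [h, hm]) hm

theorem sampleMax_congr {indep : Finset N → Prop} {g g' : N → Finset N → ℝ} {A : Finset N}
    (h : ∀ u ∈ A, g u = g' u) : sampleMax indep g A = sampleMax indep g' A := by
  unfold sampleMax
  refine iSup_congr fun u => ?_
  split_ifs with hu
  · rw [h u hu]
  · rfl

/-! ### The algorithm -/

/-- The set committed by the threshold rule after a sampling phase of length `K`; the list contains
the arrived elements, the latest first. -/
noncomputable def committed (indep : Finset N → Prop) (τ : ℝ) (K : ℕ) (g : N → Finset N → ℝ)
    (D : N → Finset N) : List N → Finset N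
  | [] => ∅
  | u :: l => if l.length < K then ∅ else
      Classical.choose
        (exists_isStep indep τ (g u) (D u) l.toFinset u (committed indep τ K g D l))

/-- Only oracle answers for arrived elements enter, so those of a view give the same set as the true
ones. -/
theorem committed_congr {indep : Finset N → Prop} {τ : ℝ} {K : ℕ} {g g' : N → Finset N → ℝ}
    {D D' : N → Finset N} {l : List N} (hg : ∀ u ∈ l, g u = g' u) (hD : ∀ u ∈ l, D u = D' u) :
    committed indep τ K g D l = committed indep τ K g' D' l := by
  induction l with
  | nil => rfl
  | cons u l ih =>
    have ih' := ih (fun v hv => hg v (List.mem_cons_of_mem _ hv))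
      (fun v hv => hD v (List.mem_cons_of_mem _ hv))
    simp only [committed, ih', hg u List.mem_cons_self, hD u List.mem_cons_self]

theorem committed_of_length_le {indep : Finset N → Prop} {τ : ℝ} {K : ℕ} {g : N → Finset N → ℝ}
    {D : N → Finset N} {l : List N} (h : l.length ≤ K) : committed indep τ K g D l = ∅ := by
  cases l with
  | nil => rfl
  | cons u l =>
    rw [List.length_cons] at h
    rw [committed, if_pos (by omega)]

theorem isStep_committed {indep : Finset N → Prop} {τ : ℝ} {K : ℕ} {g : N → Finset N → ℝ}
    {D : N → Finset N} {u : N} {l : List N} (h : K ≤ l.length) :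
    IsStep indep τ (g u) (D u) l.toFinset u (committed indep τ K g D l)
      (committed indep τ K g D (u :: l)) := by
  conv_rhs => rw [committed, if_neg (not_lt.2 h)]
  exact Classical.choose_spec
    (exists_isStep indep τ (g u) (D u) l.toFinset u (committed indep τ K g D l))

/-- The answers of the marginal oracle as a total function. -/
noncomputable def View.marg (v : View N) (u : N) (S : Finset N) : ℝ :=
  open Classical in if h : u ∈ v.arrived then v.marginalOracle ⟨u, h⟩ S else 0

/-- The answers of the supermodular oracle as a total function. -/
noncomputable def View.dep (v : View N) (u : N) : Finset N :=
  open Classical in if h : u ∈ v.arrived then v.supermodularOracle ⟨u, h⟩ else ∅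

open Classical in
/-- The rule with sampling phase of length `K` and threshold `c` times the largest sample value. -/
noncomputable def thresholdRule (indep : Finset N → Prop) (c : ℝ) (K : ℕ) : DecisionRule N :=
  fun v => decide (∃ u, v.arrived.getLast? = some u ∧
    u ∈ committed indep (c * sampleMax indep v.marg (v.arrived.take K).toFinset) K v.marg v.dep
      v.arrived.reverse)

/-- The largest value of a single element that arrives among the first `K`. -/
noncomputable def sampleValue (M : Matroid N) (f : Finset N → ℝ)
    (σ : Fin (Fintype.card N) ≃ N) (K : ℕ) : ℝ :=
  sampleMax (fun S : Finset N => M.Indep (S : Set N)) (marginal f) (past σ K)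

/-- The state of the threshold rule after `t` arrivals. -/
noncomputable def runState (M : Matroid N) (f : Finset N → ℝ) (c : ℝ)
    (σ : Fin (Fintype.card N) ≃ N) (K t : ℕ) : Finset N :=
  committed (fun S : Finset N => M.Indep (S : Set N)) (c * sampleValue M f σ K) K (marginal f)
    (depSet f) ((List.ofFn σ).take t).reverse

theorem toFinset_take_ofFn (σ : Fin (Fintype.card N) ≃ N) (t : ℕ) :
    ((List.ofFn σ).take t).toFinset = past σ t := by
  ext x
  rw [List.mem_toFinset, mem_past, List.mem_take_iff_getElem]
  constructor
  · rintro ⟨i, hi, rfl⟩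
    simp at hi ⊢
    omega
  · intro h
    exact ⟨σ.symm x, by simpa using h, by simp⟩

theorem isRun_runState (M : Matroid N) (f : Finset N → ℝ) (c : ℝ)
    (σ : Fin (Fintype.card N) ≃ N) (K : ℕ) :
    IsRun M f (c * sampleValue M f σ K) σ K (runState M f c σ K) where
  zero t ht := committed_of_length_le (by simp; omega)
  step i hi := by
    have h1 : ((List.ofFn σ).take (i + 1)).reverse = σ i :: ((List.ofFn σ).take i).reverse := by
      rw [List.take_add_one, List.getElem?_eq_getElem (by simp)]
      simp
    unfold runState
    rw [h1, ← toFinset_take_ofFn, ← List.toFinset_reverse]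
    exact isStep_committed (by simpa using hi)

/-- The decision on an element is its membership in the state right after its arrival. States
increase and nothing is committed after arriving, so this is membership in the final state. -/
theorem output_thresholdRule (M : Matroid N) (f : Finset N → ℝ) (c : ℝ)
    (σ : Fin (Fintype.card N) ≃ N) (K : ℕ) :
    output (thresholdRule (fun S : Finset N => M.Indep (S : Set N)) c K) f σ
      = runState M f c σ K (Fintype.card N) := by
  have hrun := isRun_runState M f c σ K
  have key : ∀ i : Fin (Fintype.card N),
      thresholdRule (fun S : Finset N => M.Indep (S : Set N)) c K (viewAt f σ i) = true ↔
        σ i ∈ runState M f c σ K (i + 1) := by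
    intro i
    have hm : ∀ u ∈ (viewAt f σ i).arrived, (viewAt f σ i).marg u = marginal f u := by
      intro u hu
      funext S
      simp only [View.marg, dif_pos hu]
      rfl
    have hd : ∀ u ∈ (viewAt f σ i).arrived, (viewAt f σ i).dep u = depSet f u := by
      intro u hu
      simp only [View.dep, dif_pos hu]
      rfl
    have hl : (viewAt f σ i).arrived.getLast? = some (σ i) := by
      change ((List.ofFn σ).take (i + 1)).getLast? = _
      rw [List.take_add_one, List.getElem?_eq_getElem (by simp)]
      simp
    simp only [thresholdRule, decide_eq_true_eq, hl, Option.some.injEq, exists_eq_left']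
    rw [committed_congr (g' := marginal f) (D' := depSet f) (by simpa using hm) (by simpa using hd),
      sampleMax_congr (g' := marginal f) (by
        intro u hu
        exact hm u (List.mem_of_mem_take (List.mem_toFinset.1 hu)))]
    change σ i ∈ committed _ (c * sampleMax _ _ (((List.ofFn σ).take (i + 1)).take K).toFinset) K _ _
      ((List.ofFn σ).take (i + 1)).reverse ↔ _
    -- During the sampling phase the view yields only a partial sample maximum, but then the
    -- committed set is empty for every threshold.
    by_cases hK : K ≤ (i : ℕ) + 1
    · rw [List.take_take, min_eq_left hK, toFinset_take_ofFn]
      rfl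
    · rw [hrun.zero _ (by omega), committed_of_length_le (by simp; omega)]
  ext x
  obtain ⟨i, rfl⟩ := σ.surjective x
  have h1 : σ i ∈ output (thresholdRule (fun S : Finset N => M.Indep (S : Set N)) c K) f σ ↔
      σ i ∈ runState M f c σ K (i + 1) := by
    rw [← key i]
    simp [output]
  rw [h1]
  constructor
  · exact fun h => hrun.subset_of_le (Nat.succ_le_of_lt i.2) le_rfl h
  · exact fun h => hrun.mem_of_mem_past (Nat.succ_le_of_lt i.2) le_rfl (by simp [mem_past]) h

/-- The value selected by the threshold rule. -/
noncomputable def selectedValue (M : Matroid N) (f : Finset N → ℝ) (c : ℝ)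
    (σ : Fin (Fintype.card N) ≃ N) (K : ℕ) : ℝ :=
  f (runState M f c σ K (Fintype.card N))

/-- The value of a single element. -/
noncomputable def soloValue (M : Matroid N) (f : Finset N → ℝ) (u : N) : ℝ :=
  bestMarginal (fun S : Finset N => M.Indep (S : Set N)) (marginal f u) u

theorem sampleValue_nonneg (M : Matroid N) {f : Finset N → ℝ} (hf : Monotone f)
    (σ : Fin (Fintype.card N) ≃ N) (K : ℕ) : 0 ≤ sampleValue M f σ K :=
  sampleMax_nonneg (fun u S => marginal_nonneg hf u S) _

/-- Dyadic decomposition: if the first term does not suffice, take the least j with 2·2^-j W < w;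
then w ≤ 4·2^-j W. In the induction, a new term of the sum exactly equals the old remainder 2·2^-L
W. -/
theorem le_two_mul_add_sum {W w : ℝ} (hW : 0 ≤ W) (hw : w ≤ W) (L : ℕ) :
    w ≤ 2 * ((1 / 2) ^ L * W) + ∑ j ∈ Finset.range (L + 1),
      if 2 * ((1 / 2) ^ j * W) < w then 4 * ((1 / 2) ^ j * W) else 0 := by
  induction L with
  | zero =>
    have : 0 ≤ (if 2 * ((1 / 2) ^ 0 * W) < w then 4 * ((1 / 2) ^ 0 * W) else 0) := by
      split_ifs <;> positivity
    simp only [zero_add, Finset.sum_range_one]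
    linarith
  | succ L ih =>
    rw [Finset.sum_range_succ]
    split_ifs with h
    · have : (1 / 2 : ℝ) ^ (L + 1) = 1 / 2 * (1 / 2) ^ L := pow_succ' _ _
      have : 0 ≤ (1 / 2 : ℝ) ^ L * W := by positivity
      nlinarith
    · have : 0 ≤ ∑ j ∈ Finset.range (L + 1),
          if 2 * ((1 / 2) ^ j * W) < w then 4 * ((1 / 2) ^ j * W) else 0 :=
        Finset.sum_nonneg fun j _ => by split_ifs <;> positivity
      linarith

/-- The geometric thresholds together account for every independent set that arrives after the
sampling phase and whose elements have values within the sampled one. -/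
theorem le_sum_selectedValue {M : Matroid N} {f : Finset N → ℝ} (hf0 : ∀ S, 0 ≤ f S)
    (hf : Monotone f) {σ : Fin (Fintype.card N) ≃ N} {K L : ℕ} {Y : Finset N}
    (hY : M.Indep (Y : Set N)) (hK : ∀ u ∈ Y, K ≤ (σ.symm u : ℕ)) (hL : Y.card ≤ 2 ^ L)
    (hW : ∀ u ∈ Y, soloValue M f u ≤ sampleValue M f σ K) :
    f Y - f ∅ ≤ 2 * sampleValue M f σ K + 8 * ((supermodularDegree f : ℝ) + 1) ^ 2 *
      ∑ j ∈ Finset.range (L + 1), selectedValue M f ((1 / 2) ^ j) σ K := by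
  set W := sampleValue M f σ K with hWdef
  have hW0 : 0 ≤ W := sampleValue_nonneg M hf σ K
  set w : N → ℝ := fun u => marginal f u (Y.filter fun y => (σ.symm u : ℕ) < σ.symm y) with hw
  have hwW : ∀ u ∈ Y, w u ≤ W := fun u hu =>
    le_trans (le_bestMarginal (indep := fun S : Finset N => M.Indep (S : Set N)) (marginal f u)
      (hY.subset (Finset.coe_subset.2
        (Finset.insert_subset hu (Finset.filter_subset _ _))))) (hW u hu)
  have hsum : f Y - f ∅ = ∑ u ∈ Y, w u := by
    rw [eq_add_sum_marginal f (Fin.val_injective.comp σ.symm.injective) Y]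
    simp [hw]
  rw [hsum]
  refine (Finset.sum_le_sum fun u hu => le_two_mul_add_sum hW0 (hwW u hu) L).trans ?_
  rw [Finset.sum_add_distrib, Finset.sum_comm, Finset.mul_sum]
  refine add_le_add ?_ (Finset.sum_le_sum fun j _ => ?_)
  -- The remainder at scale 2^-L is paid by at most 2^L elements.
  · rw [Finset.sum_const, nsmul_eq_mul]
    have h1 : (Y.card : ℝ) ≤ 2 ^ L := by exact_mod_cast hL
    have h2 : (2 : ℝ) ^ L * (1 / 2) ^ L = 1 := by rw [← mul_pow]; norm_num
    calc (Y.card : ℝ) * (2 * ((1 / 2) ^ L * W)) ≤ 2 ^ L * (2 * ((1 / 2) ^ L * W)) :=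
          mul_le_mul_of_nonneg_right h1 (by positivity)
      _ = 2 * (2 ^ L * (1 / 2) ^ L) * W := by ring
      _ = 2 * W := by rw [h2]; ring
  · rw [← Finset.sum_filter, Finset.sum_const, nsmul_eq_mul]
    have := (isRun_runState M f ((1 / 2) ^ j) σ K).threshold_mul_card_le (by positivity) hf0 hf hY hK
    unfold selectedValue
    simp only [← hWdef] at this
    simp only [hw]
    linarith

/-- When `u` is the first arrival of `insert u S` and the sample dominates all values outside of this
set, the two largest thresholds together collect half of the marginal of `u`. -/
theorem marginal_le_selectedValue {M : Matroid N} {f : Finset N → ℝ} (hf0 : ∀ S, 0 ≤ f S)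
    (hf : Monotone f) {σ : Fin (Fintype.card N) ≃ N} {K : ℕ} {u : N} {S : Finset N}
    (hS : M.Indep ((insert u S : Finset N) : Set N)) (hSD : S ⊆ depSet f u)
    (hmax : ∀ x, x ∉ insert u S → soloValue M f x ≤ sampleValue M f σ K)
    (hK : K ≤ (σ.symm u : ℕ)) (hfirst : ∀ x ∈ S, σ.symm u ≤ σ.symm x)
    (hu : sampleValue M f σ K ≤ marginal f u S) :
    marginal f u S ≤ 2 * (selectedValue M f 1 σ K + selectedValue M f (1 / 2) σ K) := by
  set W := sampleValue M f σ K with hWdef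
  have hW0 : 0 ≤ W := sampleValue_nonneg M hf σ K
  have h1 : 0 ≤ selectedValue M f 1 σ K := hf0 _
  have h2 : 0 ≤ selectedValue M f (1 / 2) σ K := hf0 _
  obtain ⟨i, rfl⟩ := σ.surjective u
  simp only [Equiv.symm_apply_apply] at hK hfirst
  have hpast : S ⊆ depSet f (σ i) \ past σ i := fun x hx =>
    Finset.mem_sdiff.2 ⟨hSD hx, fun hp => by
      have := hfirst x hx
      rw [mem_past] at hp
      rw [Fin.le_def] at this
      omega⟩
  -- In case of a tie with W the strict test at threshold W may fail. Threshold W/2 then commits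
  -- something, unless the marginal is 0, and any commitment is worth W/2.
  by_cases hWm : marginal f (σ i) S ≤ W
  · have hrun := isRun_runState M f (1 / 2) σ K
    rcases hrun.threshold_le hf0 _ le_rfl with h3 | h3
    · have hsub : ∀ t ≤ Fintype.card N, runState M f (1 / 2) σ K t = ∅ := fun t ht =>
        Finset.subset_empty.1 (h3 ▸ hrun.subset_of_le ht le_rfl)
      rcases hrun.step i hK with ⟨_, h4⟩ | ⟨S', _, _, h4, _⟩
      · have := h4 S hpast (by rw [hsub _ i.2.le]; simpa using hS)
        rw [hsub _ i.2.le, Finset.empty_union, ← hWdef] at this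
        unfold selectedValue at *
        linarith
      · rw [hsub _ (Nat.succ_le_of_lt i.2)] at h4
        exact absurd h4.symm (Finset.insert_ne_empty _ _)
    · rw [← hWdef] at h3
      unfold selectedValue at *
      linarith
  · have hrun := isRun_runState M f 1 σ K
    rw [← hWdef, one_mul] at hrun
    have hempty : ∀ t ≤ (i : ℕ), runState M f 1 σ K t = ∅ := by
      intro t
      induction t with
      | zero => exact fun _ => hrun.zero 0 (Nat.zero_le K)
      | succ t ih =>
        intro ht
        by_cases hKt : K ≤ t
        · have htn : t < Fintype.card N := lt_of_lt_of_le ht i.2.le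
          rcases hrun.step ⟨t, htn⟩ hKt with ⟨h4, _⟩ | ⟨S', _, h5, _, h6, _⟩
          · exact h4.trans (ih (by omega))
          -- Before u only elements outside `insert u S` arrive, and their values do not exceed W.
          · exfalso
            simp only [ih (by omega), Finset.empty_union] at h5 h6
            have h7 : σ ⟨t, htn⟩ ∉ insert (σ i) S := by
              rw [Finset.mem_insert]
              rintro (h | h)
              · have := Fin.val_eq_of_eq (σ.injective h)
                simp at this
                omega
              · have := hfirst _ h
                rw [Equiv.symm_apply_apply, Fin.le_def] at this
                simp at this
                omega
            have h8 := hmax _ h7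
            have h9 : marginal f (σ ⟨t, htn⟩) S' ≤ soloValue M f (σ ⟨t, htn⟩) :=
              le_bestMarginal (indep := fun S : Finset N => M.Indep (S : Set N)) _ h5
            linarith
        · exact hrun.zero _ (by omega)
    have hi := hempty i le_rfl
    rcases hrun.step i hK with ⟨_, h4⟩ | ⟨S', _, _, h4, _, h5⟩
    · have := h4 S hpast (by rw [hi]; simpa using hS)
      rw [hi, Finset.empty_union] at this
      exact absurd this hWm
    · have h6 := h5 S hpast (by rw [hi]; simpa using hS)
      rw [hi, Finset.empty_union, Finset.empty_union] at h6
      rw [hi, Finset.empty_union] at h4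
      have h7 := hf (hrun.subset_of_le (Nat.succ_le_of_lt i.2) le_rfl)
      rw [h4] at h7
      have h8 := hf0 S'
      unfold selectedValue at *
      simp only [marginal] at h6 ⊢
      linarith

end Algorithm

/-! ### Distribution of the sampled set and of the first arrival -/

section Sampling

variable {N : Type*} [Fintype N] [DecidableEq N]

/-! ### The random sampling phase -/

/-- The average over a uniformly random order and a binomial length of the sampling phase. -/
noncomputable def avg (p : ℝ) (F : (Fin (Fintype.card N) ≃ N) → ℕ → ℝ) : ℝ :=
  ∑ σ : Fin (Fintype.card N) ≃ N, ∑ K ∈ Finset.range (Fintype.card N + 1),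
    ((Fintype.card N).factorial : ℝ)⁻¹ *
      (p ^ K * (1 - p) ^ (Fintype.card N - K) * (Fintype.card N).choose K) * F σ K

variable {p : ℝ}

theorem avg_mono (hp0 : 0 ≤ p) (hp1 : p ≤ 1) {F G : (Fin (Fintype.card N) ≃ N) → ℕ → ℝ}
    (h : ∀ σ K, F σ K ≤ G σ K) : avg p F ≤ avg p G := by
  have : 0 ≤ 1 - p := sub_nonneg.2 hp1
  exact Finset.sum_le_sum fun σ _ => Finset.sum_le_sum fun K _ =>
    mul_le_mul_of_nonneg_left (h σ K) (by positivity)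

theorem avg_add (F G : (Fin (Fintype.card N) ≃ N) → ℕ → ℝ) :
    avg p (fun σ K => F σ K + G σ K) = avg p F + avg p G := by
  simp only [avg, mul_add, Finset.sum_add_distrib]

theorem avg_sub (F G : (Fin (Fintype.card N) ≃ N) → ℕ → ℝ) :
    avg p (fun σ K => F σ K - G σ K) = avg p F - avg p G := by
  simp only [avg, mul_sub, Finset.sum_sub_distrib]

theorem avg_mul_left (c : ℝ) (F : (Fin (Fintype.card N) ≃ N) → ℕ → ℝ) :
    avg p (fun σ K => c * F σ K) = c * avg p F := by
  simp only [avg, Finset.mul_sum]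
  exact Finset.sum_congr rfl fun σ _ => Finset.sum_congr rfl fun K _ => by ring

theorem avg_sum {ι : Type*} (s : Finset ι) (F : ι → (Fin (Fintype.card N) ≃ N) → ℕ → ℝ) :
    avg p (fun σ K => ∑ i ∈ s, F i σ K) = ∑ i ∈ s, avg p (F i) := by
  classical
  induction s using Finset.induction_on with
  | empty => simp [avg]
  | insert i s hi ih =>
    simp only [Finset.sum_insert hi]
    rw [avg_add, ih]

theorem avg_congr {F G : (Fin (Fintype.card N) ≃ N) → ℕ → ℝ} (h : ∀ σ K, F σ K = G σ K) :
    avg p F = avg p G :=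
  congrArg _ (funext fun σ => funext fun K => h σ K)

theorem avg_comp_trans (e : Equiv.Perm N) (F : (Fin (Fintype.card N) ≃ N) → ℕ → ℝ) :
    avg p (fun σ K => F (σ.trans e) K) = avg p F := by
  unfold avg
  exact Fintype.sum_equiv (Equiv.equivCongr (Equiv.refl _) e) _ _ fun σ => rfl

theorem card_past (σ : Fin (Fintype.card N) ≃ N) {K : ℕ} (hK : K ≤ Fintype.card N) :
    (past σ K).card = K := by
  rw [← toFinset_take_ofFn, List.toFinset_card_of_nodup]
  · simpa using hK
  · exact (List.nodup_ofFn.2 σ.injective).sublist (List.take_sublist _ _)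

theorem past_trans (σ : Fin (Fintype.card N) ≃ N) (e : Equiv.Perm N) (K : ℕ) :
    past (σ.trans e) K = (past σ K).map e.toEmbedding := by
  ext x
  simp [mem_past, Finset.mem_map_equiv]

/-- A permutation carrying A to A' acts bijectively on the orders. -/
theorem card_filter_past_eq {K : ℕ} {A A' : Finset N} (h : A.card = A'.card) :
    (Finset.univ.filter fun σ : Fin (Fintype.card N) ≃ N => past σ K = A).card =
      (Finset.univ.filter fun σ : Fin (Fintype.card N) ≃ N => past σ K = A').card := by
  obtain ⟨e, he⟩ : ∃ e : Equiv.Perm N, A.map e.toEmbedding = A' := by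
    refine ⟨(Finset.equivOfCardEq h).extendSubtype, ?_⟩
    refine Finset.eq_of_subset_of_card_le (fun x hx => ?_) (by simp [h])
    obtain ⟨a, ha, rfl⟩ := Finset.mem_map.1 hx
    exact Equiv.extendSubtype_mem _ _ ha
  refine Finset.card_equiv (Equiv.equivCongr (Equiv.refl _) e) fun σ => ?_
  have : (Equiv.equivCongr (Equiv.refl _) e) σ = σ.trans e := rfl
  rw [this]
  simp only [Finset.mem_filter, Finset.mem_univ, true_and, past_trans, ← he]
  exact (Finset.map_injective _).eq_iff.symm

/-- The first K arrivals form a uniform K-subset; those avoiding R are the K-subsets of its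
complement. The case R = ∅ eliminates the common fibre size c. -/
theorem card_filter_disjoint_past (R : Finset N) {K : ℕ} (hK : K ≤ Fintype.card N) :
    (Finset.univ.filter fun σ : Fin (Fintype.card N) ≃ N => Disjoint R (past σ K)).card *
      (Fintype.card N).choose K =
    (Fintype.card N).factorial * (Fintype.card N - R.card).choose K := by
  obtain ⟨A₀, _, hA₀⟩ := Finset.exists_subset_card_eq (s := (Finset.univ : Finset N)) (n := K)
    (by simpa using hK)
  set c := (Finset.univ.filter fun σ : Fin (Fintype.card N) ≃ N => past σ K = A₀).card with hc
  have key : ∀ R : Finset N,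
      (Finset.univ.filter fun σ : Fin (Fintype.card N) ≃ N => Disjoint R (past σ K)).card =
        (Fintype.card N - R.card).choose K * c := by
    intro R
    rw [Finset.card_eq_sum_card_fiberwise (f := fun σ => past σ K)
      (t := Finset.powersetCard K Rᶜ)]
    · rw [Finset.sum_congr rfl (g := fun _ => c), Finset.sum_const, Finset.card_powersetCard,
        Finset.card_compl, smul_eq_mul]
      intro A hA
      obtain ⟨hA1, hA2⟩ := Finset.mem_powersetCard.1 hA
      rw [hc, card_filter_past_eq (hA₀.trans hA2.symm), Finset.filter_filter]
      congr 1
      ext σ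
      simp only [Finset.mem_filter, Finset.mem_univ, true_and, and_iff_right_iff_imp]
      rintro rfl
      exact (Finset.subset_compl_iff_disjoint_left).1 hA1
    · intro σ hσ
      simp only [Finset.coe_filter, Finset.mem_univ, true_and] at hσ
      exact Finset.mem_coe.2 (Finset.mem_powersetCard.2
        ⟨(Finset.subset_compl_iff_disjoint_left).2 hσ, card_past σ hK⟩)
  have h1 := key ∅
  have h2 : Fintype.card (Fin (Fintype.card N) ≃ N) = (Fintype.card N).factorial := by
    rw [Fintype.card_equiv (Fintype.equivFin N).symm, Fintype.card_fin]
  simp only [Finset.disjoint_empty_left, Finset.filter_true, Finset.card_univ, h2,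
    Finset.card_empty, Nat.sub_zero] at h1
  rw [key R, h1]
  ring

/-- The elements of `R` all arrive after the sampling phase. -/
theorem avg_disjoint_past (R : Finset N) :
    avg p (fun σ K => if Disjoint R (past σ K) then 1 else 0) = (1 - p) ^ R.card := by
  have hR : R.card ≤ Fintype.card N := Finset.card_le_univ R
  unfold avg
  rw [Finset.sum_comm]
  have h1 : ∀ K ∈ Finset.range (Fintype.card N + 1),
      (∑ σ : Fin (Fintype.card N) ≃ N, ((Fintype.card N).factorial : ℝ)⁻¹ *
        (p ^ K * (1 - p) ^ (Fintype.card N - K) * (Fintype.card N).choose K) *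
          (if Disjoint R (past σ K) then 1 else 0)) =
      p ^ K * (1 - p) ^ (Fintype.card N - K) * (Fintype.card N - R.card).choose K := by
    intro K hK
    have hK' : K ≤ Fintype.card N := Nat.lt_succ_iff.1 (Finset.mem_range.1 hK)
    have h2 : ((Finset.univ.filter fun σ : Fin (Fintype.card N) ≃ N =>
        Disjoint R (past σ K)).card : ℝ) * (Fintype.card N).choose K =
        (Fintype.card N).factorial * (Fintype.card N - R.card).choose K := by
      exact_mod_cast card_filter_disjoint_past R hK'
    have h3 : ((Fintype.card N).factorial : ℝ) ≠ 0 := by positivity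
    rw [← Finset.mul_sum, Finset.sum_boole]
    field_simp
    linear_combination (p ^ K * (1 - p) ^ (Fintype.card N - K)) * h2
  rw [Finset.sum_congr rfl h1]
  obtain ⟨m, hm⟩ := Nat.exists_eq_add_of_le hR
  rw [hm, Nat.add_sub_cancel_left]
  -- Terms with K > m = n - |R| vanish, and the others sum to (1-p)^|R| by the binomial theorem.
  have h4 : Finset.range (m + 1) ⊆ Finset.range (R.card + m + 1) :=
    Finset.range_subset_range.2 (by omega)
  rw [← Finset.sum_subset h4]
  · have h5 := add_pow p (1 - p) m
    rw [add_sub_cancel, one_pow] at h5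
    rw [← mul_one ((1 - p) ^ R.card)]
    refine Eq.trans ?_ (congrArg _ h5.symm)
    rw [Finset.mul_sum]
    refine Finset.sum_congr rfl fun K hK => ?_
    have : R.card + m - K = R.card + (m - K) := by
      have := Finset.mem_range.1 hK
      omega
    rw [this, pow_add]
    ring
  · intro K _ hK
    rw [Nat.choose_eq_zero_of_lt (by simpa [Nat.lt_succ_iff] using hK)]
    simp

theorem avg_const (c : ℝ) : avg (N := N) p (fun _ _ => c) = c := by
  have h := avg_disjoint_past (N := N) (p := p) ∅
  simp only [Finset.disjoint_empty_left, if_true, Finset.card_empty, pow_zero] at h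
  have h2 := avg_mul_left (N := N) (p := p) c (fun _ _ => 1)
  rw [h] at h2
  simpa using h2

/-- The event is "R is missed" minus "R ∪ H is missed"; the product form expresses independence of
disjoint sets. -/
theorem avg_disjoint_past_not_disjoint {R H : Finset N} (hRH : Disjoint R H) :
    avg p (fun σ K => if Disjoint R (past σ K) ∧ ¬ Disjoint H (past σ K) then 1 else 0) =
      (1 - p) ^ R.card * (1 - (1 - p) ^ H.card) := by
  have h : avg p (fun σ K =>
      if Disjoint R (past σ K) ∧ ¬ Disjoint H (past σ K) then (1 : ℝ) else 0) =
      avg p (fun σ K => (if Disjoint R (past σ K) then 1 else 0) -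
        (if Disjoint (R ∪ H) (past σ K) then 1 else 0)) := by
    refine avg_congr fun σ K => ?_
    simp only [Finset.disjoint_union_left]
    by_cases h1 : Disjoint R (past σ K) <;> by_cases h2 : Disjoint H (past σ K) <;> simp [h1, h2]
  rw [h, avg_sub, avg_disjoint_past, avg_disjoint_past, Finset.card_union_of_disjoint hRH, pow_add]
  ring

/-- By symmetry, each element of `R` is equally likely to be its first arrival. -/
theorem card_mul_avg_first {R : Finset N} {u : N} (hu : u ∈ R)
    (G : Finset N → Prop) [DecidablePred G] (hG : ∀ A, ∀ x ∈ R, Disjoint R A →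
      (G (A.map (Equiv.swap u x).toEmbedding) ↔ G A)) :
    R.card * avg p (fun σ K => if (Disjoint R (past σ K) ∧ G (past σ K)) ∧
        ∀ y ∈ R, σ.symm u ≤ σ.symm y then 1 else 0) =
      avg p (fun σ K => if Disjoint R (past σ K) ∧ G (past σ K) then 1 else 0) := by
  have h1 : ∀ x ∈ R, avg p (fun σ K => if (Disjoint R (past σ K) ∧ G (past σ K)) ∧
        ∀ y ∈ R, σ.symm x ≤ σ.symm y then (1 : ℝ) else 0) =
      avg p (fun σ K => if (Disjoint R (past σ K) ∧ G (past σ K)) ∧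
        ∀ y ∈ R, σ.symm u ≤ σ.symm y then (1 : ℝ) else 0) := by
    intro x hx
    have hmem : ∀ y, Equiv.swap u x y ∈ R ↔ y ∈ R := by
      intro y
      by_cases h : y = u
      · subst h; simp [hu, hx]
      · by_cases h' : y = x
        · subst h'; simp [hu, hx]
        · rw [Equiv.swap_apply_of_ne_of_ne h h']
    -- Swapping u and x in the order exchanges the roles of the two as first arrival and preserves
    -- R.
    rw [← avg_comp_trans (Equiv.swap u x)]
    refine avg_congr fun σ K => ?_
    have hdis : Disjoint R (past (σ.trans (Equiv.swap u x)) K) ↔ Disjoint R (past σ K) := by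
      simp only [Finset.disjoint_left, mem_past, Equiv.symm_trans_apply, Equiv.symm_swap]
      constructor
      · intro h y hy
        simpa using h ((hmem y).2 hy)
      · intro h y hy
        exact h ((hmem y).2 hy)
    have hfst : (∀ y ∈ R, (σ.trans (Equiv.swap u x)).symm x ≤ (σ.trans (Equiv.swap u x)).symm y) ↔
        ∀ y ∈ R, σ.symm u ≤ σ.symm y := by
      simp only [Equiv.symm_trans_apply, Equiv.symm_swap, Equiv.swap_apply_right]
      constructor
      · intro h y hy
        simpa using h _ ((hmem y).2 hy)
      · intro h y hy
        exact h _ ((hmem y).2 hy)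
    have hGG : Disjoint R (past σ K) →
        (G (past (σ.trans (Equiv.swap u x)) K) ↔ G (past σ K)) := by
      intro h
      rw [past_trans]
      exact hG _ x hx h
    refine if_congr ?_ rfl rfl
    rw [hdis, hfst]
    tauto
  rw [← nsmul_eq_mul, ← Finset.sum_const, ← Finset.sum_congr rfl h1, ← avg_sum]
  refine avg_congr fun σ K => ?_
  by_cases hc : Disjoint R (past σ K) ∧ G (past σ K)
  · obtain ⟨x, hx, hmin⟩ := Finset.exists_min_image R σ.symm ⟨u, hu⟩
    rw [if_pos hc, Finset.sum_eq_single_of_mem x hx, if_pos ⟨hc, hmin⟩]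
    intro y hy hne
    rw [if_neg]
    rintro ⟨_, h⟩
    exact hne (σ.symm.injective (le_antisymm (h x hx) (hmin y hy)))
  · simp [hc]

/-- V holds the best element outside R, and is empty if R is everything; in that case the factor p
is merely given away. -/
theorem avg_first_ge (hp1 : p ≤ 1) {R V : Finset N} (hRV : Disjoint R V)
    (hV : V.card ≤ 1) {u : N} (hu : u ∈ R) :
    p * (1 - p) ^ R.card ≤ R.card * avg p (fun σ K =>
      if (Disjoint R (past σ K) ∧ V ⊆ past σ K) ∧ ∀ y ∈ R, σ.symm u ≤ σ.symm y then 1 else 0) := by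
  have h0 : 0 ≤ 1 - p := sub_nonneg.2 hp1
  rw [card_mul_avg_first hu (fun A => V ⊆ A)]
  · rcases Nat.le_one_iff_eq_zero_or_eq_one.1 hV with h | h
    · rw [Finset.card_eq_zero.1 h]
      simp only [Finset.empty_subset, and_true]
      rw [avg_disjoint_past]
      exact mul_le_of_le_one_left (by positivity) hp1
    · obtain ⟨v, rfl⟩ := Finset.card_eq_one.1 h
      have := avg_disjoint_past_not_disjoint (p := p) hRV
      simp only [Finset.disjoint_singleton_left, not_not, Finset.card_singleton, pow_one,
        sub_sub_cancel] at this
      simp only [Finset.singleton_subset_iff]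
      rw [this, mul_comm]
  · intro A x hx hRA
    have hfix : ∀ v ∈ V, Equiv.swap u x v = v := fun v hv =>
      Equiv.swap_apply_of_ne_of_ne
        (fun h => Finset.disjoint_left.1 hRV hu (h ▸ hv))
        (fun h => Finset.disjoint_left.1 hRV hx (h ▸ hv))
    refine forall₂_congr fun v hv => ?_
    rw [Finset.mem_map_equiv, Equiv.symm_swap, hfix v hv]

end Sampling

/-! ### Expected value and competitive ratio -/

section Competitive

variable {N : Type u} [Fintype N] [DecidableEq N]

/-! ### The randomized algorithm -/

/-- The binomial law of the length of the sampling phase. -/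
noncomputable def phaseLaw (p : ℝ) (hp0 : 0 ≤ p) (hp1 : p ≤ 1) (n : ℕ) : PMF (Fin (n + 1)) :=
  PMF.ofFintype
    (fun K => ENNReal.ofReal (p ^ (K : ℕ) * (1 - p) ^ (n - K : ℕ) * n.choose K)) (by
      have h0 : 0 ≤ 1 - p := sub_nonneg.2 hp1
      rw [← ENNReal.ofReal_sum_of_nonneg fun K _ => by positivity,
        Fin.sum_univ_eq_sum_range (fun K => p ^ K * (1 - p) ^ (n - K) * (n.choose K : ℝ)),
        ← add_pow]
      simp)

/-- The largest cardinality of an independent set. -/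
noncomputable def rankOf (indep : Finset N → Prop) : ℕ :=
  open Classical in (Finset.univ.filter indep).sup Finset.card

/-- The factor between the threshold and the largest sample value. -/
noncomputable def scale {L : ℕ} (x : Fin 3 × Fin (L + 1)) : ℝ :=
  -- The factors 1 and 1/2 get constant probability, so that competing with single elements costs no
  -- factor L.
  if x.1 = 0 then 1 else if x.1 = 1 then 1 / 2 else (1 / 2) ^ (x.2 : ℕ)

/-- The sampling probability. -/
noncomputable def sampleProb (d : ℕ) : ℝ := 1 / ((d : ℝ) + 2)

theorem sampleProb_nonneg (d : ℕ) : 0 ≤ sampleProb d := by unfold sampleProb; positivity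

theorem sampleProb_le_one (d : ℕ) : sampleProb d ≤ 1 := by
  unfold sampleProb
  rw [div_le_one (by positivity)]
  have : (0 : ℝ) ≤ d := Nat.cast_nonneg d
  linarith

/-- The randomized algorithm: a threshold rule with a binomial sampling phase and a random
geometric threshold. -/
noncomputable def thresholdAlgorithm : SecretaryAlgorithm.{u} := fun N _ _ d indep =>
  (phaseLaw (sampleProb d) (sampleProb_nonneg d) (sampleProb_le_one d) (Fintype.card N)).bind
    fun K => (PMF.uniformOfFintype (Fin 3 × Fin (Nat.clog 2 (rankOf indep) + 1))).map
      fun x => thresholdRule indep (scale x) K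

theorem sum_bind_toReal_mul {α β : Type*} [Fintype α] [Fintype β] (q : PMF α) (g : α → PMF β)
    (f : β → ℝ) :
    ∑ b, ((q.bind g) b).toReal * f b = ∑ a, (q a).toReal * ∑ b, (g a b).toReal * f b := by
  simp only [PMF.bind_apply, tsum_fintype]
  simp_rw [ENNReal.toReal_sum (fun a _ => ENNReal.mul_ne_top (q.apply_ne_top a)
    ((g a).apply_ne_top _)), ENNReal.toReal_mul, Finset.sum_mul, Finset.mul_sum]
  rw [Finset.sum_comm]
  exact Finset.sum_congr rfl fun _ _ => Finset.sum_congr rfl fun _ _ => mul_assoc _ _ _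

theorem sum_map_toReal_mul {α β : Type*} [Fintype α] [Fintype β] [DecidableEq β] (q : PMF α)
    (g : α → β) (f : β → ℝ) :
    ∑ b, ((q.map g) b).toReal * f b = ∑ a, (q a).toReal * f (g a) := by
  rw [← PMF.bind_pure_comp, sum_bind_toReal_mul]
  refine Finset.sum_congr rfl fun a _ => ?_
  congr 1
  rw [Finset.sum_eq_single (g a)]
  · simp
  · intro b _ hb
    simp [hb]
  · simp

theorem isFeasibleOn_thresholdAlgorithm (f : Finset N → ℝ) (M : Matroid N) :
    IsFeasibleOn thresholdAlgorithm f M := by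
  intro S hS
  simp only [outputLaw, thresholdAlgorithm, PMF.mem_support_bind_iff, PMF.support_map,
    Set.mem_image] at hS
  obtain ⟨σ, _, r, ⟨K, _, x, _, rfl⟩, rfl⟩ := hS
  rw [output_thresholdRule]
  exact (isRun_runState M f _ σ _).indep _ le_rfl

theorem expectedValue_thresholdAlgorithm (f : Finset N → ℝ) (M : Matroid N) {L : ℕ}
    (hL : L = Nat.clog 2 (rankOf fun S : Finset N => M.Indep (S : Set N))) :
    expectedValue thresholdAlgorithm f M = (3 * ((L : ℝ) + 1))⁻¹ *
      (((L : ℝ) + 1) * avg (sampleProb (supermodularDegree f)) (selectedValue M f 1) +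
        ((L : ℝ) + 1) * avg (sampleProb (supermodularDegree f)) (selectedValue M f (1 / 2)) +
        ∑ j ∈ Finset.range (L + 1),
          avg (sampleProb (supermodularDegree f)) (selectedValue M f ((1 / 2) ^ j))) := by
  subst hL
  set L := Nat.clog 2 (rankOf fun S : Finset N => M.Indep (S : Set N)) with hL
  set p := sampleProb (supermodularDegree f) with hp
  have hp1 : 0 ≤ 1 - p := sub_nonneg.2 (sampleProb_le_one _)
  have hp0 : 0 ≤ p := sampleProb_nonneg _
  have h1 : expectedValue thresholdAlgorithm f M =
      ∑ x : Fin 3 × Fin (L + 1), (3 * ((L : ℝ) + 1))⁻¹ * avg p (selectedValue M f (scale x)) := by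
    simp only [expectedValue, outputLaw, thresholdAlgorithm, PMF.map_bind, PMF.map_comp]
    rw [sum_bind_toReal_mul]
    simp_rw [sum_bind_toReal_mul, sum_map_toReal_mul, Function.comp_apply, output_thresholdRule]
    simp only [avg, Finset.mul_sum]
    conv_rhs => rw [Finset.sum_comm]
    refine Finset.sum_congr rfl fun σ _ => ?_
    conv_rhs => rw [Finset.sum_comm]
    rw [← Fin.sum_univ_eq_sum_range (fun K => ∑ x : Fin 3 × Fin (L + 1), (3 * ((L : ℝ) + 1))⁻¹ *
      (((Fintype.card N).factorial : ℝ)⁻¹ * (p ^ K * (1 - p) ^ (Fintype.card N - K) *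
        (Fintype.card N).choose K) * selectedValue M f (scale x) σ K))]
    refine Finset.sum_congr rfl fun K _ => Finset.sum_congr rfl fun x _ => ?_
    have e1 : ((arrivalLaw N) σ).toReal = ((Fintype.card N).factorial : ℝ)⁻¹ := by
      have : Nonempty (Fin (Fintype.card N) ≃ N) := ⟨(Fintype.equivFin N).symm⟩
      rw [arrivalLaw, PMF.uniformOfFintype_apply,
        Fintype.card_equiv (Fintype.equivFin N).symm, Fintype.card_fin]
      simp
    have e2 : (phaseLaw p (sampleProb_nonneg _) (sampleProb_le_one _) (Fintype.card N) K).toReal =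
        p ^ (K : ℕ) * (1 - p) ^ (Fintype.card N - K : ℕ) * (Fintype.card N).choose K := by
      rw [phaseLaw, PMF.ofFintype_apply, ENNReal.toReal_ofReal (by positivity)]
    have e3 : (PMF.uniformOfFintype (Fin 3 × Fin (L + 1)) x).toReal = (3 * ((L : ℝ) + 1))⁻¹ := by
      rw [PMF.uniformOfFintype_apply, Fintype.card_prod, Fintype.card_fin, Fintype.card_fin,
        ENNReal.toReal_inv]
      norm_cast
    rw [e1, e2, e3]
    unfold selectedValue
    ring
  rw [h1, ← Finset.mul_sum, Fintype.sum_prod_type, Fin.sum_univ_three]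
  congr 1
  simp only [scale, if_true, Fin.isValue, one_ne_zero, if_false, Fin.reduceEq, Finset.sum_const,
    Finset.card_univ, Fintype.card_fin, nsmul_eq_mul, Nat.cast_add, Nat.cast_one]
  congr 1
  exact Fin.sum_univ_eq_sum_range (fun j => avg p (selectedValue M f ((1 / 2) ^ j))) (L + 1)

/-! ### The competitive ratio -/

/-- The inverse of 1 - p is 1 + 1/(d+1), whose power d+1 is at most e. -/
theorem one_third_le_pow (d : ℕ) : 1 / 3 ≤ (1 - sampleProb d) ^ (d + 1) := by
  have hd : (0 : ℝ) ≤ d := Nat.cast_nonneg d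
  have h1 : (1 - sampleProb d) = (1 + 1 / ((d : ℝ) + 1))⁻¹ := by
    unfold sampleProb
    field_simp
    ring
  have h2 : (1 + 1 / ((d : ℝ) + 1)) ^ (d + 1) ≤ 3 := by
    have h3 := Real.add_one_le_exp (1 / ((d : ℝ) + 1))
    calc (1 + 1 / ((d : ℝ) + 1)) ^ (d + 1) ≤ (Real.exp (1 / ((d : ℝ) + 1))) ^ (d + 1) :=
          pow_le_pow_left₀ (by positivity) (by linarith) _
      _ = Real.exp 1 := by
          rw [← Real.exp_nat_mul]
          congr 1
          push_cast
          field_simp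
      _ ≤ 3 := by linarith [Real.exp_one_lt_d9]
  rw [h1, inv_pow, one_div]
  exact inv_anti₀ (by positivity) h2

/-- Bernoulli's inequality for the power d+1 of 1 + 1/(d+1). -/
theorem pow_le_one_half (d : ℕ) : (1 - sampleProb d) ^ (d + 1) ≤ 1 / 2 := by
  have hd : (0 : ℝ) ≤ d := Nat.cast_nonneg d
  have h1 : (1 - sampleProb d) = (1 + 1 / ((d : ℝ) + 1))⁻¹ := by
    unfold sampleProb
    field_simp
    ring
  have h2 : 2 ≤ (1 + 1 / ((d : ℝ) + 1)) ^ (d + 1) := by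
    have h3 := one_add_mul_le_pow (a := 1 / ((d : ℝ) + 1))
      (by have : 0 ≤ 1 / ((d : ℝ) + 1) := by positivity
          linarith) (d + 1)
    have h4 : 1 + ((d + 1 : ℕ) : ℝ) * (1 / ((d : ℝ) + 1)) = 2 := by
      push_cast
      field_simp
      norm_num
    linarith
  rw [h1, inv_pow, one_div (2 : ℝ)]
  exact inv_anti₀ (by positivity) h2

theorem one_third_le_pow_of_le {d r : ℕ} (hr : r ≤ d + 1) : 1 / 3 ≤ (1 - sampleProb d) ^ r :=
  (one_third_le_pow d).trans (pow_le_pow_of_le_one (sub_nonneg.2 (sampleProb_le_one d))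
    (by linarith [sampleProb_nonneg d]) hr)

theorem soloValue_nonneg (M : Matroid N) {f : Finset N → ℝ} (hf : Monotone f) (u : N) :
    0 ≤ soloValue M f u :=
  bestMarginal_nonneg (fun S => marginal_nonneg hf u S) u

/-- The two largest thresholds compete with every single element. -/
theorem soloValue_le {M : Matroid N} {f : Finset N → ℝ} (hf0 : ∀ S, 0 ≤ f S) (hf : Monotone f)
    (u₀ : N) :
    soloValue M f u₀ ≤ 12 * ((supermodularDegree f : ℝ) + 1) ^ 2 *
      (avg (sampleProb (supermodularDegree f)) (selectedValue M f 1) +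
        avg (sampleProb (supermodularDegree f)) (selectedValue M f (1 / 2))) := by
  set p := sampleProb (supermodularDegree f) with hp
  have hp1 : p ≤ 1 := sampleProb_le_one _
  have hp0 : 0 ≤ p := sampleProb_nonneg _
  obtain ⟨u, -, hmax⟩ := Finset.exists_max_image Finset.univ (soloValue M f)
    ⟨u₀, Finset.mem_univ u₀⟩
  refine (hmax u₀ (Finset.mem_univ _)).trans ?_
  have havg : ∀ c, 0 ≤ avg p (selectedValue M f c) := fun c => by
    have := avg_mono (N := N) hp0 hp1 (F := fun _ _ => 0) (G := selectedValue M f c)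
      fun σ K => hf0 _
    rwa [avg_const] at this
  rcases (soloValue_nonneg M hf u).eq_or_lt with h0 | h0
  · rw [← h0]
    have := havg 1
    have := havg (1 / 2)
    positivity
  obtain ⟨S₀, hS₀, hval⟩ := exists_eq_bestMarginal h0
  change marginal f u S₀ = soloValue M f u at hval
  -- Restriction to dependencies loses no value and leaves |R| ≤ d + 1.
  set S := S₀ ∩ depSet f u with hSdef
  have hS : M.Indep ((insert u S : Finset N) : Set N) :=
    hS₀.subset (Finset.coe_subset.2 (Finset.insert_subset_insert _ Finset.inter_subset_left))
  have hval' : soloValue M f u ≤ marginal f u S :=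
    hval.symm.le.trans (marginal_le_inter_depSet f u S₀)
  set R := insert u S with hR
  obtain ⟨V, hRV, hV, hVmax⟩ : ∃ V : Finset N, Disjoint R V ∧ V.card ≤ 1 ∧
      ∀ A, V ⊆ A → ∀ x, x ∉ R → ∃ v ∈ A, soloValue M f x ≤ soloValue M f v := by
    rcases Rᶜ.eq_empty_or_nonempty with h | h
    · exact ⟨∅, by simp, by simp, fun A _ x hx => by
        rw [← Finset.mem_compl, h] at hx
        simp at hx⟩
    · obtain ⟨v, hv, hvmax⟩ := Finset.exists_max_image Rᶜ (soloValue M f) h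
      refine ⟨{v}, ?_, by simp, fun A hA x hx => ⟨v, ?_, hvmax x (Finset.mem_compl.2 hx)⟩⟩
      · simpa using hv
      · simpa using hA
  have hRc : R.card ≤ supermodularDegree f + 1 :=
    (Finset.card_insert_le _ _).trans (Nat.add_le_add_right
      ((Finset.card_le_card Finset.inter_subset_right).trans (card_depSet_le f u)) 1)
  have hpt : ∀ σ K, soloValue M f u * (if (Disjoint R (past σ K) ∧ V ⊆ past σ K) ∧
      ∀ y ∈ R, σ.symm u ≤ σ.symm y then (1 : ℝ) else 0) ≤
      2 * (selectedValue M f 1 σ K + selectedValue M f (1 / 2) σ K) := by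
    intro σ K
    have n1 : 0 ≤ selectedValue M f 1 σ K := hf0 _
    have n2 : 0 ≤ selectedValue M f (1 / 2) σ K := hf0 _
    split_ifs with h
    · obtain ⟨⟨h1, h2⟩, h3⟩ := h
      rw [mul_one]
      refine hval'.trans (marginal_le_selectedValue hf0 hf hS Finset.inter_subset_right ?_ ?_
        (fun x hx => h3 x (Finset.mem_insert_of_mem hx)) ?_)
      · intro x hx
        obtain ⟨v, hv, hxv⟩ := hVmax _ h2 x hx
        exact hxv.trans (le_sampleMax (marginal f) hv)
      · have := Finset.disjoint_left.1 h1 (Finset.mem_insert_self u S)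
        rw [mem_past] at this
        omega
      · exact le_trans (sampleMax_le (soloValue_nonneg M hf u)
          fun x => hmax x (Finset.mem_univ x)) hval'
    · rw [mul_zero]
      positivity
  have h1 := avg_mono hp0 hp1 hpt
  rw [avg_mul_left, avg_mul_left, avg_add] at h1
  have h2 := avg_first_ge hp1 hRV hV (Finset.mem_insert_self u S)
  set P := avg p (fun σ K => if (Disjoint R (past σ K) ∧ V ⊆ past σ K) ∧
      ∀ y ∈ R, σ.symm u ≤ σ.symm y then (1 : ℝ) else 0) with hP
  have hP0 : 0 ≤ P := by
    have := avg_mono (N := N) hp0 hp1 (F := fun _ _ => 0) (G := fun σ K =>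
      if (Disjoint R (past σ K) ∧ V ⊆ past σ K) ∧ ∀ y ∈ R, σ.symm u ≤ σ.symm y then (1 : ℝ) else 0)
      fun σ K => by split_ifs <;> norm_num
    rwa [avg_const] at this
  set d : ℝ := (supermodularDegree f : ℝ) with hd
  have hd0 : 0 ≤ d := Nat.cast_nonneg _
  have hRd : (R.card : ℝ) ≤ d + 1 := by
    rw [hd]
    exact_mod_cast hRc
  -- The probability P is at least p/(3(d+1)), and (d+2)(d+1) ≤ 2(d+1)².
  have h3 : 1 ≤ 6 * (d + 1) ^ 2 * P := by
    have h4 : p * (1 / 3) ≤ (d + 1) * P :=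
      (mul_le_mul_of_nonneg_left (one_third_le_pow_of_le hRc) hp0).trans
        (h2.trans (mul_le_mul_of_nonneg_right hRd hP0))
    have h5 : p * (d + 2) = 1 := by
      rw [hp, sampleProb, ← hd]
      field_simp
    have h6 := mul_le_mul_of_nonneg_left h4 (by linarith : 0 ≤ 3 * (d + 2))
    have h7 : 3 * (d + 2) * (p * (1 / 3)) = 1 := by linarith
    have h8 : 0 ≤ d * (d + 1) * P := by positivity
    nlinarith
  have h9 := mul_le_mul_of_nonneg_left h3 h0.le
  have h10 := mul_le_mul_of_nonneg_left h1 (by positivity : 0 ≤ 6 * (d + 1) ^ 2)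
  nlinarith

theorem card_le_rankOf {M : Matroid N} {T : Finset N} (hT : M.Indep (T : Set N)) :
    T.card ≤ rankOf fun S : Finset N => M.Indep (S : Set N) := by
  unfold rankOf
  refine Finset.le_sup (f := Finset.card) ?_
  simpa using hT

theorem rankOf_le {M : Matroid N} {k : ℕ} (hk : M.eRank = k) :
    rankOf (fun S : Finset N => M.Indep (S : Set N)) ≤ k := by
  unfold rankOf
  refine Finset.sup_le fun T hT => ?_
  have hT' : M.Indep (T : Set N) := by simpa using hT
  have h := hT'.encard_le_eRank
  rw [hk, Set.encard_coe_eq_coe_finsetCard] at h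
  exact_mod_cast h

/-- Removing a set loses at most the single values of its elements. -/
theorem le_sdiff_add {M : Matroid N} {f : Finset N → ℝ} {T : Finset N}
    (hT : M.Indep (T : Set N)) {m : ℝ} (hm : ∀ u, soloValue M f u ≤ m) (hm0 : 0 ≤ m)
    (hf : Monotone f) (H : Finset N) : f T ≤ f (T \ H) + H.card * m := by
  induction H using Finset.induction_on with
  | empty => simp
  | insert a H ha ih =>
    rw [Finset.card_insert_of_notMem ha]
    push_cast
    have h1 : f (T \ H) ≤ f (T \ insert a H) + m := by
      by_cases haT : a ∈ T
      · have h2 : T \ H = insert a (T \ insert a H) := by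
          ext x
          simp only [Finset.mem_sdiff, Finset.mem_insert]
          by_cases hx : x = a
          · subst hx; simp [haT, ha]
          · simp [hx]
        have h3 : marginal f a (T \ insert a H) ≤ m :=
          (le_bestMarginal (indep := fun S : Finset N => M.Indep (S : Set N)) _ (by
            rw [← h2]
            exact hT.subset (Finset.coe_subset.2 Finset.sdiff_subset))).trans (hm a)
        rw [h2]
        simp only [marginal] at h3
        linarith
      · have h2 : T \ H ⊆ T \ insert a H := fun x hx => by
          simp only [Finset.mem_sdiff, Finset.mem_insert] at hx ⊢
          refine ⟨hx.1, ?_⟩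
          rintro (rfl | h)
          · exact haT hx.1
          · exact hx.2 h
        linarith [hf h2]
    linarith

/-- The elements with the `r` largest values of a function. -/
theorem exists_top_subset (v : N → ℝ) {r : ℕ} (hr : r ≤ Fintype.card N) :
    ∃ H : Finset N, H.card = r ∧ ∀ h ∈ H, ∀ x, x ∉ H → v x ≤ v h := by
  induction r with
  | zero => exact ⟨∅, by simp⟩
  | succ r ih =>
    obtain ⟨H, hc, hH⟩ := ih (by omega)
    have hne : Hᶜ.Nonempty := by
      rw [← Finset.card_pos, Finset.card_compl]
      omega
    obtain ⟨a, ha, hmax⟩ := Finset.exists_max_image Hᶜ v hne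
    rw [Finset.mem_compl] at ha
    refine ⟨insert a H, by rw [Finset.card_insert_of_notMem ha, hc], ?_⟩
    intro h hh x hx
    rw [Finset.mem_insert, not_or] at hx
    rcases Finset.mem_insert.1 hh with rfl | hh
    · exact hmax x (Finset.mem_compl.2 hx.2)
    · exact hH h hh x hx.2

/-- A sixth of the value of a set survives the sampling phase, even on the event that a disjoint
set of `d + 1` elements is sampled. -/
theorem le_avg_sdiff_past {f : Finset N → ℝ} (hf : Monotone f) {Y H : Finset N}
    (hYH : Disjoint Y H) (hH : H.card = supermodularDegree f + 1) :
    f Y - f ∅ ≤ 6 * avg (sampleProb (supermodularDegree f)) (fun σ K =>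
      if ¬ Disjoint H (past σ K) then f (Y \ past σ K) - f ∅ else 0) := by
  set p := sampleProb (supermodularDegree f) with hp
  have hp1 : p ≤ 1 := sampleProb_le_one _
  have hp0 : 0 ≤ p := sampleProb_nonneg _
  have hpos : Function.Injective fun u : N => (Fintype.equivFin N u : ℕ) :=
    Fin.val_injective.comp (Fintype.equivFin N).injective
  set w : N → Finset N → ℝ := fun u Z =>
    marginal f u (Z.filter fun y => (Fintype.equivFin N u : ℕ) < Fintype.equivFin N y) with hw
  have hsum : ∀ Z : Finset N, f Z - f ∅ = ∑ u ∈ Z, w u Z := fun Z => by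
    rw [eq_add_sum_marginal f hpos Z]
    simp [hw]
  -- If u and its dependencies in Y all miss the sample, only non-dependencies are removed, so the
  -- marginal of u does not drop.
  have hpt : ∀ σ K, (∑ u ∈ Y, w u Y * if Disjoint (insert u (Y ∩ depSet f u)) (past σ K) ∧
      ¬ Disjoint H (past σ K) then (1 : ℝ) else 0) ≤
      if ¬ Disjoint H (past σ K) then f (Y \ past σ K) - f ∅ else 0 := by
    intro σ K
    by_cases hd : Disjoint H (past σ K)
    · simp [hd]
    · simp only [hd, not_false_eq_true, and_true, if_true]
      rw [hsum, ← Finset.sum_subset (Finset.sdiff_subset : Y \ past σ K ⊆ Y)]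
      · refine Finset.sum_le_sum fun u hu => ?_
        split_ifs with h
        · rw [mul_one]
          refine marginal_le_of_disjoint (Finset.filter_subset_filter _ Finset.sdiff_subset)
            fun x hx hx' hxd => ?_
          obtain ⟨hx1, hx2⟩ := Finset.mem_filter.1 hx
          refine hx' (Finset.mem_filter.2 ⟨Finset.mem_sdiff.2 ⟨hx1, ?_⟩, hx2⟩)
          exact Finset.disjoint_left.1 h
            (Finset.mem_insert_of_mem (Finset.mem_inter.2 ⟨hx1, hxd⟩))
        · rw [mul_zero]
          exact marginal_nonneg hf _ _
      · intro u hu hu'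
        rw [if_neg, mul_zero]
        intro h
        exact hu' (Finset.mem_sdiff.2 ⟨hu, Finset.disjoint_left.1 h (Finset.mem_insert_self _ _)⟩)
  have h1 := avg_mono hp0 hp1 hpt
  rw [avg_sum] at h1
  rw [hsum]
  refine le_trans ?_ (mul_le_mul_of_nonneg_left h1 (by norm_num))
  rw [Finset.mul_sum]
  refine Finset.sum_le_sum fun u hu => ?_
  have hw0 : 0 ≤ w u Y := marginal_nonneg hf _ _
  have hsub : insert u (Y ∩ depSet f u) ⊆ Y := Finset.insert_subset hu Finset.inter_subset_left
  rw [avg_mul_left, avg_disjoint_past_not_disjoint (Finset.disjoint_of_subset_left hsub hYH), hH]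
  have h2 : 1 / 3 ≤ (1 - p) ^ (insert u (Y ∩ depSet f u)).card :=
    one_third_le_pow_of_le ((Finset.card_insert_le _ _).trans (Nat.add_le_add_right
      ((Finset.card_le_card Finset.inter_subset_right).trans (card_depSet_le f u)) 1))
  have h3 : 1 / 2 ≤ 1 - (1 - p) ^ (supermodularDegree f + 1) := by
    linarith [pow_le_one_half (supermodularDegree f)]
  have h4 : 1 / 3 * (1 / 2) ≤ (1 - p) ^ (insert u (Y ∩ depSet f u)).card *
      (1 - (1 - p) ^ (supermodularDegree f + 1)) :=
    mul_le_mul h2 h3 (by norm_num) (by linarith)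
  have h5 := mul_le_mul_of_nonneg_left h4 hw0
  linarith

/-- The random thresholds compete with every independent set, up to a few single elements. -/
theorem le_sum_avg_selectedValue {M : Matroid N} {f : Finset N → ℝ} (hf0 : ∀ S, 0 ≤ f S)
    (hf : Monotone f) {T : Finset N} (hT : M.Indep (T : Set N)) {L : ℕ} (hL : T.card ≤ 2 ^ L)
    {m : ℝ} (hm : ∀ u, soloValue M f u ≤ m) (hm0 : 0 ≤ m) :
    f T ≤ f ∅ + ((supermodularDegree f : ℝ) + 13) * m +
      48 * ((supermodularDegree f : ℝ) + 1) ^ 2 * ∑ j ∈ Finset.range (L + 1),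
        avg (sampleProb (supermodularDegree f)) (selectedValue M f ((1 / 2) ^ j)) := by
  set p := sampleProb (supermodularDegree f) with hp
  have hp1 : p ≤ 1 := sampleProb_le_one _
  have hp0 : 0 ≤ p := sampleProb_nonneg _
  set d : ℝ := (supermodularDegree f : ℝ) with hd
  have hd0 : 0 ≤ d := Nat.cast_nonneg _
  set F : (Fin (Fintype.card N) ≃ N) → ℕ → ℝ := fun σ K =>
    2 * m + 8 * (d + 1) ^ 2 * ∑ j ∈ Finset.range (L + 1), selectedValue M f ((1 / 2) ^ j) σ K with hF
  have hF0 : ∀ σ K, 0 ≤ F σ K := fun σ K => by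
    have : 0 ≤ ∑ j ∈ Finset.range (L + 1), selectedValue M f ((1 / 2) ^ j) σ K :=
      Finset.sum_nonneg fun j _ => hf0 _
    positivity
  have hFavg : avg p F = 2 * m + 8 * (d + 1) ^ 2 * ∑ j ∈ Finset.range (L + 1),
      avg p (selectedValue M f ((1 / 2) ^ j)) := by
    rw [hF, avg_add, avg_const, avg_mul_left, avg_sum]
  have hFavg0 : 0 ≤ avg p F := by
    have := avg_mono (N := N) hp0 hp1 (F := fun _ _ => 0) (G := F) hF0
    rwa [avg_const] at this
  obtain ⟨H, hHc, hH⟩ : ∃ H : Finset N, H.card ≤ supermodularDegree f + 1 ∧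
      f (T \ H) - f ∅ ≤ 6 * avg p F := by
    by_cases hn : supermodularDegree f + 1 ≤ Fintype.card N
    · obtain ⟨H, hHc, hH⟩ := exists_top_subset (soloValue M f) hn
      refine ⟨H, hHc.le, (le_avg_sdiff_past hf Finset.sdiff_disjoint hHc).trans
        (mul_le_mul_of_nonneg_left (avg_mono hp0 hp1 fun σ K => ?_) (by norm_num))⟩
      split_ifs with hdis
      · exact hF0 σ K
      -- A sampled element of H dominates every value outside H, hence all of T \ H.
      · obtain ⟨h, hhH, hhp⟩ := Finset.not_disjoint_iff.1 hdis
        have hsub : (T \ H) \ past σ K ⊆ T := Finset.sdiff_subset.trans Finset.sdiff_subset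
        refine (le_sum_selectedValue hf0 hf (σ := σ) (K := K) (L := L)
          (hT.subset (Finset.coe_subset.2 hsub)) ?_ ((Finset.card_le_card hsub).trans hL)
          ?_).trans ?_
        · intro u hu
          have := (Finset.mem_sdiff.1 hu).2
          rw [mem_past] at this
          omega
        · intro u hu
          exact (hH h hhH u (Finset.mem_sdiff.1 (Finset.mem_sdiff.1 hu).1).2).trans
            (le_sampleMax (marginal f) hhp)
        · have : sampleValue M f σ K ≤ m := sampleMax_le hm0 hm
          simp only [hF, hd]
          linarith
    · refine ⟨Finset.univ, by rw [Finset.card_univ]; omega, ?_⟩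
      rw [Finset.sdiff_eq_empty_iff_subset.2 (Finset.subset_univ T), sub_self]
      positivity
  -- The coefficient d + 13 is d + 1 for deleting H plus 6·2 from the term 2m in F.
  have h1 := le_sdiff_add hT hm hm0 hf H
  have h2 : (H.card : ℝ) * m ≤ (d + 1) * m :=
    mul_le_mul_of_nonneg_right (by rw [hd]; exact_mod_cast hHc) hm0
  rw [hFavg] at hH
  linarith

/-- For r > 1, minimality of `Nat.clog` gives 2^(clog r - 1) < r, and 1/log 2 < 2. -/
theorem clog_le (k r : ℕ) (hr : r ≤ k) :
    (Nat.clog 2 r : ℝ) ≤ 1 + 2 * Real.log ((k : ℝ) + 1) := by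
  have hlog : 0 ≤ Real.log ((k : ℝ) + 1) := Real.log_nonneg (by
    have : (0 : ℝ) ≤ k := Nat.cast_nonneg k
    linarith)
  rcases Nat.lt_or_ge 1 r with h | h
  · have h1 := Nat.pow_pred_clog_lt_self (b := 2) one_lt_two h
    have h2 : 0 < Nat.clog 2 r := Nat.clog_pos one_lt_two h
    have h3 : (2 : ℝ) ^ (Nat.clog 2 r - 1) ≤ (k : ℝ) + 1 := by
      have : 2 ^ (Nat.clog 2 r - 1) ≤ k + 1 := by
        have : 2 ^ (Nat.clog 2 r - 1) < r := h1
        omega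
      exact_mod_cast this
    have h4 := Real.log_le_log (by positivity) h3
    rw [Real.log_pow, Nat.cast_sub h2, Nat.cast_one] at h4
    have h5 := Real.log_two_gt_d9
    have h6 : (1 : ℝ) ≤ Nat.clog 2 r := by exact_mod_cast h2
    nlinarith
  · rw [Nat.clog_of_right_le_one h]
    simp only [Nat.cast_zero]
    linarith

theorem isCompetitiveOn_thresholdAlgorithm {f : Finset N → ℝ} {M : Matroid N} {k : ℕ}
    (hf0 : ∀ S, 0 ≤ f S) (hf : Monotone f) (hk : M.eRank = k) :
    IsCompetitiveOn thresholdAlgorithm f M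
      (2000 * (((supermodularDegree f : ℝ) + 1) ^ 3 * Real.log ((supermodularDegree f : ℝ) + 2)
        + ((supermodularDegree f : ℝ) + 1) ^ 2 * Real.log ((k : ℝ) + 1))) := by
  intro T hT
  set p := sampleProb (supermodularDegree f) with hp
  have hp1 : p ≤ 1 := sampleProb_le_one _
  have hp0 : 0 ≤ p := sampleProb_nonneg _
  obtain ⟨L, hL⟩ : ∃ L, L = Nat.clog 2 (rankOf fun S : Finset N => M.Indep (S : Set N)) := ⟨_, rfl⟩
  have hE := expectedValue_thresholdAlgorithm f M hL
  set E := expectedValue thresholdAlgorithm f M with hEdef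
  rw [← hp] at hE
  set a := avg p (selectedValue M f 1) with ha
  set b := avg p (selectedValue M f (1 / 2)) with hb
  set s := ∑ j ∈ Finset.range (L + 1), avg p (selectedValue M f ((1 / 2) ^ j)) with hs
  have hL0 : (0 : ℝ) ≤ L := Nat.cast_nonneg L
  have hsel : ∀ c, f ∅ ≤ avg p (selectedValue M f c) := fun c => by
    have := avg_mono (N := N) hp0 hp1 (F := fun _ _ => f ∅) (G := selectedValue M f c)
      fun σ K => hf (Finset.empty_subset _)
    rwa [avg_const] at this
  have h0 := hf0 ∅
  have ha0 : 0 ≤ a := h0.trans (hsel _)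
  have hb0 : 0 ≤ b := h0.trans (hsel _)
  have hs0 : 0 ≤ s := Finset.sum_nonneg fun j _ => h0.trans (hsel _)
  have hE' : 3 * ((L : ℝ) + 1) * E = ((L : ℝ) + 1) * a + ((L : ℝ) + 1) * b + s := by
    rw [hE]
    field_simp
  have hsE : s ≤ 3 * ((L : ℝ) + 1) * E := by
    rw [hE']
    have : 0 ≤ ((L : ℝ) + 1) * a := by positivity
    have : 0 ≤ ((L : ℝ) + 1) * b := by positivity
    linarith
  have habE : a + b ≤ 3 * E := by
    have : ((L : ℝ) + 1) * (a + b) ≤ ((L : ℝ) + 1) * (3 * E) := by linarith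
    exact le_of_mul_le_mul_left this (by positivity)
  have hE0 : 0 ≤ E := by linarith
  set d : ℝ := (supermodularDegree f : ℝ) with hd
  have hd0 : 0 ≤ d := Nat.cast_nonneg _
  have hsolo : ∀ u, soloValue M f u ≤ 36 * (d + 1) ^ 2 * E := fun u =>
    (soloValue_le hf0 hf u).trans (by
      have := mul_le_mul_of_nonneg_left habE (by positivity : 0 ≤ 12 * (d + 1) ^ 2)
      linarith)
  have hTL : T.card ≤ 2 ^ L := (card_le_rankOf hT).trans
    (hL ▸ Nat.le_pow_clog one_lt_two _)
  have hmain := le_sum_avg_selectedValue hf0 hf hT hTL hsolo (by positivity)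
  rw [← hp, ← hs, ← hd] at hmain
  have hlogk : 0 ≤ Real.log ((k : ℝ) + 1) := Real.log_nonneg (by
    have : (0 : ℝ) ≤ k := Nat.cast_nonneg k
    linarith)
  have hLk : (L : ℝ) ≤ 1 + 2 * Real.log ((k : ℝ) + 1) := hL ▸ clog_le k _ (rankOf_le hk)
  have hlogd : 1 / 2 ≤ Real.log (d + 2) := by
    have h1 := Real.log_two_gt_d9
    have h2 := Real.log_le_log two_pos (by linarith : (2 : ℝ) ≤ d + 2)
    linarith
  have t1 : 48 * (d + 1) ^ 2 * s ≤ 144 * ((d + 1) ^ 2 * (2 + 2 * Real.log ((k : ℝ) + 1))) * E := by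
    have h1 : s ≤ 3 * (2 + 2 * Real.log ((k : ℝ) + 1)) * E :=
      hsE.trans (mul_le_mul_of_nonneg_right (by linarith) hE0)
    have h2 := mul_le_mul_of_nonneg_left h1 (by positivity : 0 ≤ 48 * (d + 1) ^ 2)
    linarith
  -- Every selected set has value at least f(∅), so f(∅) ≤ a ≤ a + b.
  have t2 : f ∅ ≤ 3 * E := by linarith [hsel 1]
  have t3 : f T ≤ (3 + (d + 13) * (36 * (d + 1) ^ 2) +
      144 * ((d + 1) ^ 2 * (2 + 2 * Real.log ((k : ℝ) + 1)))) * E := by linarith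
  refine t3.trans (mul_le_mul_of_nonneg_right ?_ hE0)
  -- The terms free of log k add up to at most (3 + 468 + 288)(d+1)³. As log(d+2) ≥ 1/2, twice 759
  -- suffices, which is below 2000.
  have u1 : (d + 1) ^ 2 ≤ (d + 1) ^ 3 := pow_le_pow_right₀ (by linarith) (by norm_num)
  have u2 : 1 ≤ (d + 1) ^ 3 := one_le_pow₀ (by linarith)
  have u3 : (d + 13) * (36 * (d + 1) ^ 2) ≤ 468 * (d + 1) ^ 3 := by
    have : 0 ≤ d * (d + 1) ^ 2 := by positivity
    nlinarith
  have u4 : (d + 1) ^ 3 * (1 / 2) ≤ (d + 1) ^ 3 * Real.log (d + 2) :=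
    mul_le_mul_of_nonneg_left hlogd (by positivity)
  have u5 : 0 ≤ (d + 1) ^ 2 * Real.log ((k : ℝ) + 1) := by positivity
  nlinarith

end Competitive

end MatroidSecretary

theorem theorem2 :
    ∃ C : ℝ, 0 < C ∧ ∃ A : MatroidSecretary.SecretaryAlgorithm.{u},
      ∀ (N : Type u) [Fintype N] [DecidableEq N] (f : Finset N → ℝ) (M : Matroid N) (d k : ℕ),
        (∀ S : Finset N, 0 ≤ f S) → Monotone f →
        M.E = Set.univ → M.eRank = (k : ℕ∞) → MatroidSecretary.supermodularDegree f = d →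
          MatroidSecretary.IsFeasibleOn A f M ∧
          MatroidSecretary.IsCompetitiveOn A f M
            (C * (((d : ℝ) + 1) ^ 3 * Real.log ((d : ℝ) + 2)
              + ((d : ℝ) + 1) ^ 2 * Real.log ((k : ℝ) + 1))) := by
  refine ⟨2000, by norm_num, MatroidSecretary.thresholdAlgorithm, ?_⟩
  intro N _ _ f M d k hf0 hf _ hk hd
  subst hd
  exact ⟨MatroidSecretary.isFeasibleOn_thresholdAlgorithm f M,
    MatroidSecretary.isCompetitiveOn_thresholdAlgorithm hf0 hf hk⟩
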